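/- **Algebras.** A GMTL-algebra is a commutative integral distributive residuated lattice $(A,\wedge,\vee,\cdot,\to,1)$ with $(a\to b)\vee(b\to a)=1$; an MTL-algebra is a GMTL-algebra with a least element $0$, and $\neg a:=a\to 0$, $a\oplus b:=\neg(\neg a\cdot\neg b)$. An SBP-algebra is an MTL-algebra satisfying $\neg(a^2)\to(\neg\neg a\to a)=1$ and $(2a)^2=2(a^2)$, where $2a=a\oplus a$. Its Boolean skeleton $\mathscr B(A)$ is the set of complemented elements, and its radical $\mathscr R(A)$ is the intersection of its maximal deductive filters. **Spaces.** For a Priestley space $Y$ with a ternary relation $R$, put $R[U,V,-]=\{z:\exists x\in U,\,y\in V,\ R(x,y,z)\}$. An unpointed residuated space is a Priestley space $Y$ with a ternary relation $R$ and a clopen up-set $E$ such that, for all points and all clopen up-sets $U,V$: (1) $\exists t\,(R(x,y,t)\wedge R(t,z,w))\iff\exists t\,(R(y,z,t)\wedge R(x,t,w))$; (2) $R$ is antitone in its first two arguments and isotone in the third; (3) if $R(x,y,z)$ fails, there are clopen up-sets $U\ni x$, $V\ni y$ with $z\notin R[U,V,-]$; (4) $R[U,V,-]$, $\{z:R[\{z\},V,-]\subseteq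 U\}$ and $\{z:R[V,\{z\},-]\subseteq U\}$ are clopen; (5) $R[U,E,-]=R[E,U,-]=U$. It is an $\mathsf{MTL}^\tau$-space if moreover $R(x,y,z)\iff R(y,x,z)$, $E=Y$, and $R(x,y,z),R(x,v,w)$ imply $y\le w$ or $v\le z$. A $\mathsf{GMTL}^\tau$-space is an $\mathsf{MTL}^\tau$-space with a greatest element $\top$. A $\mathsf{GMTL}^\tau$-morphism is a continuous isotone map $f:X_1\to X_2$ with $f(\top)=\top$ that preserves $R$, such that $R_2(v,w,f(z))$ implies $v\le f(x)$, $w\le f(y)$, $R_1(x,y,z)$ for some $x,y$, such that $R_1[\{x\},f^{-1}[U],-]\subseteq f^{-1}[V]$ implies $R_2[\{f(x)\},U,-]\subseteq V$ for all clopen up-sets $U,V$, and such that $f^{-1}[E_2]\subseteq E_1$. The nonempty clopen up-sets of a $\mathsf{GMTL}^\tau$-space $X$ form a GMTL-algebra $\mathcal A(X)$ under $\cap$, $\cup$, $U\cdot V=R[U,V,-]$, $U\to V=\{x:R[\{x\},U,-]\subseteq V\}$, with unit $X$. In $X$, $x\bullet y$ denotes the least $z$ with $R(x,y,z)$, and $y\Rightarrow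 z$ the greatest $x$ with $R(x,y,z)$ (when they exist). The extended Priestley dual $\mathcal S(A)$ of an MTL-algebra $A$ is the set of its prime filters, ordered by inclusion, with the topology generated by the sets $\{F:a\in F\}$ and their complements, with $R(F,G,H)\iff F\cdot G\subseteq H$, where $F\cdot G=\{ab:a\in F,b\in G\}$, and with $E=\mathcal S(A)$. The dual of a GMTL-algebra is defined in the same way, with the whole algebra counted as a prime filter (and then greatest point). For a Boolean algebra $B$, $\mathcal S(B)$ is its Stone space of ultrafilters. Isomorphisms of these spaces are order isomorphisms that are homeomorphisms and that preserve and reflect $R$ and $E$. **Dual quadruples.** A dual quadruple $(S,X,\Upsilon,\Delta)$ consists of a Stone space $S$; a $\mathsf{GMTL}^\tau$-space $X$; a family $\Upsilon$ of $\mathsf{GMTL}^\tau$-morphisms $\upsilon_U:X\to X$, indexed by the clopen $U\subseteq S$, such that $\nu_U(V):=\upsilon_U^{-1}[V]$ ($V\in\mathcal A(X)$) is an external join, i.e. (V1) each $\nu_U$ is an endomorphism of the GMTL-algebra $\mathcal A(X)$ and each $U\mapsto\nu_U(V)$ is a lattice homomorphism, (V2) $\nu_\emptyset$ is the identity and $\nu_S$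 is constantly $X$, (V3) $\nu_U(V)\cup\nu_{U'}(V')=\nu_{U\cup U'}(V\cup V')=\nu_U(\nu_{U'}(V\cup V'))$; and a continuous closure operator $\Delta:X\to X$ such that $R(x,y,z)$ implies $R(\Delta x,\Delta y,\Delta z)$. A point $s\in S$ fixes $x\in X$ if $\upsilon_U(x)=x$ for every clopen $U\subseteq S$ with $s\notin U$. Let $D=\{(s,x):s\text{ fixes }x\}$, let $D^\partial=\{+(s,\Delta x):(s,x)\in D,\ \Delta x\neq\top\}$ (a disjoint copy), and let $S\otimes^\Delta_\Upsilon X$ be $T=D\sqcup D^\partial$ with the following structure. * Order: $(s,x)\sqsubseteq(s,y)$ iff $x\le y$; $+(s,x)\sqsubseteq+(s,y)$ iff $y\le x$; $(s,x)\sqsubseteq+(s,y)$ always; no other pairs are related. * Topology: generated by the sets $W_{(U,V)}=[(U\times V)\cup+(U\times\Delta[X]\cup S\times\Delta[V]^{c})]\cap T$ and their complements, for $U\subseteq S$ clopen and $V\in\mathcal A(X)$. * Partial operation: $(s,x)\circ(s,y)=(s,x\bullet y)$; $(s,x)\circ+(s,y)=+(s,y)\circ(s,x)=+(s,x\Rightarrow\Delta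 y)$ if $x\le\Delta y$; undefined otherwise. $R(p,q,r)$ holds iff $p\circ q$ exists and $p\circ q\sqsubseteq r$; and $E=T$. **Theorem.** Let $Y=\mathcal S(A)$ be the extended Priestley dual of an SBP-algebra $A$. Then there exists a dual quadruple $(S,X,\Upsilon,\Delta)$ such that $Y\cong S\otimes^{\Delta}_{\Upsilon}X$. Moreover, up to isomorphism one can take $S=\mathcal S(\mathscr B(A))$, $X=\mathcal S(\mathscr R(A))$, $\upsilon_U(\mathfrak x)=\{x\in\mathscr R(A):u\vee x\in\mathfrak x\}$, where $u\in\mathscr B(A)$ is the element whose ultrafilters form $U$, and $\Delta(\mathfrak x)=\{x\in\mathscr R(A):\neg\neg x\in\mathfrak x\}$. -/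

import Mathlib

universe u

namespace SBPDual

open Set TopologicalSpace

/-! ## Algebras -/

/-- MTL-algebras: bounded commutative integral distributive residuated lattices that are
semilinear, i.e. satisfy `(a → b) ∨ (b → a) = 1`. The residual is written `⇨`; the top element
is the monoid unit `1` and the bottom element is `⊥`. -/
class MTLAlgebra (A : Type u) extends DistribLattice A, CommMonoid A, OrderBot A, HImp A where
  le_one : ∀ a : A, a ≤ 1
  mul_le_iff_le_himp : ∀ a b c : A, a * b ≤ c ↔ b ≤ a ⇨ c
  prelinear : ∀ a b : A, (a ⇨ b) ⊔ (b ⇨ a) = 1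

section Algebra

variable {A : Type u} [MTLAlgebra A]

/-- The negation `¬ a = a → 0`. -/
def neg (a : A) : A := a ⇨ ⊥

/-- The strong sum `a ⊕ b = ¬ (¬ a · ¬ b)`. -/
def oplus (a b : A) : A := neg (neg a * neg b)

end Algebra

/-- SBP-algebras: MTL-algebras with `¬(a²) → (¬¬a → a) = 1` and `(2a)² = 2(a²)`. -/
class SBPAlgebra (A : Type u) extends MTLAlgebra A where
  neg_sq_himp : ∀ a : A, neg (a * a) ⇨ (neg (neg a) ⇨ a) = 1
  oplus_sq : ∀ a : A, oplus a a * oplus a a = oplus (a * a) (a * a)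

section Algebra

variable (A : Type u) [MTLAlgebra A]

/-- Deductive filters: up-sets that contain `1` and are closed under the product. -/
structure IsDeductiveFilter (F : Set A) : Prop where
  one_mem : (1 : A) ∈ F
  upper : IsUpperSet F
  mul_mem : ∀ a ∈ F, ∀ b ∈ F, a * b ∈ F

/-- The radical: the intersection of the maximal deductive filters (maximal among the
proper ones). -/
def radical : Set A :=
  {x | ∀ F : Set A, Maximal (fun G => IsDeductiveFilter A G ∧ G ≠ univ) F → x ∈ F}

/-- The Boolean skeleton: the set of complemented elements. -/
def boolSkeleton : Set A := {b | ∃ c : A, b ⊔ c = 1 ∧ b ⊓ c = ⊥}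

end Algebra

/-! ## Residuated spaces -/

/-- The data of an ordered topological space with a ternary relation `R` and a distinguished
set `E`. -/
structure ResSpace : Type (u + 1) where
  carrier : Type u
  [topology : TopologicalSpace carrier]
  [order : PartialOrder carrier]
  R : carrier → carrier → carrier → Prop
  E : Set carrier

instance : CoeSort ResSpace.{u} (Type u) := ⟨ResSpace.carrier⟩
instance (Y : ResSpace.{u}) : TopologicalSpace Y := Y.topology
instance (Y : ResSpace.{u}) : PartialOrder Y := Y.order

namespace ResSpace

/-- Clopen up-sets (the empty set is allowed). -/
def IsClopenUpper (Y : ResSpace.{u}) (U : Set Y) : Prop := IsClopen U ∧ IsUpperSet U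

/-- `R[U, V, -]`. -/
def mul (Y : ResSpace.{u}) (U V : Set Y) : Set Y := {z | ∃ x ∈ U, ∃ y ∈ V, Y.R x y z}

/-- `U → V = {x : R[x, U, -] ⊆ V}`. -/
def imp (Y : ResSpace.{u}) (U V : Set Y) : Set Y := {x | Y.mul {x} U ⊆ V}

/-- Unpointed residuated spaces. -/
structure IsUnpointedResiduated (Y : ResSpace.{u}) : Prop where
  compact : CompactSpace Y
  priestley : PriestleySpace Y
  assoc : ∀ x y z w : Y, (∃ t, Y.R x y t ∧ Y.R t z w) ↔ (∃ t, Y.R y z t ∧ Y.R x t w)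
  mono : ∀ x y z x' y' z' : Y, x' ≤ x → y' ≤ y → z ≤ z' → Y.R x y z → Y.R x' y' z'
  separated : ∀ x y z : Y, ¬ Y.R x y z → ∃ U V : Set Y, Y.IsClopenUpper U ∧ Y.IsClopenUpper V ∧
    x ∈ U ∧ y ∈ V ∧ z ∉ Y.mul U V
  clopen_mul : ∀ U V : Set Y, Y.IsClopenUpper U → Y.IsClopenUpper V → IsClopen (Y.mul U V)
  clopen_right : ∀ U V : Set Y, Y.IsClopenUpper U → Y.IsClopenUpper V →
    IsClopen {z : Y | Y.mul {z} V ⊆ U}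
  clopen_left : ∀ U V : Set Y, Y.IsClopenUpper U → Y.IsClopenUpper V →
    IsClopen {z : Y | Y.mul V {z} ⊆ U}
  clopenUpper_E : Y.IsClopenUpper Y.E
  mul_E : ∀ U : Set Y, Y.IsClopenUpper U → Y.mul U Y.E = U
  E_mul : ∀ U : Set Y, Y.IsClopenUpper U → Y.mul Y.E U = U

/-- The unpointed residuated spaces dual to MTL-algebras. -/
structure IsMTL (Y : ResSpace.{u}) : Prop extends IsUnpointedResiduated Y where
  comm : ∀ x y z : Y, Y.R x y z ↔ Y.R y x z
  integral : Y.E = univ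
  prelinear : ∀ x y z v w : Y, Y.R x y z → Y.R x v w → y ≤ w ∨ v ≤ z

/-- Bounded morphisms. -/
structure IsBoundedMorphism (Y Z : ResSpace.{u}) (f : Y → Z) : Prop where
  continuous : Continuous f
  monotone : Monotone f
  map_R : ∀ x y z : Y, Y.R x y z → Z.R (f x) (f y) (f z)
  lift_R : ∀ (v w : Z) (z : Y), Z.R v w (f z) → ∃ x y : Y, v ≤ f x ∧ w ≤ f y ∧ Y.R x y z
  map_imp : ∀ U V : Set Z, Z.IsClopenUpper U → Z.IsClopenUpper V → ∀ x : Y,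
    Y.mul {x} (f ⁻¹' U) ⊆ f ⁻¹' V → Z.mul {f x} U ⊆ V
  preimage_E : f ⁻¹' Z.E ⊆ Y.E

/-- Isomorphisms: order isomorphisms that are homeomorphisms and preserve and reflect the
ternary relation and the distinguished set. -/
structure Iso (Y Z : ResSpace.{u}) extends Y.carrier ≃o Z.carrier where
  continuous_toFun : Continuous toFun
  continuous_invFun : Continuous invFun
  map_R_iff : ∀ x y z : Y, Z.R (toFun x) (toFun y) (toFun z) ↔ Y.R x y z
  map_E_iff : ∀ x : Y, toFun x ∈ Z.E ↔ x ∈ Y.E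

end ResSpace

/-- Objects of the category dual to GMTL-algebras: the MTL spaces with a greatest element. -/
structure GMTLSpace : Type (u + 1) extends ResSpace.{u} where
  isMTL : toResSpace.IsMTL
  greatest : carrier
  le_greatest : ∀ x : carrier, x ≤ greatest

instance : CoeSort GMTLSpace.{u} (Type u) := ⟨fun X => X.carrier⟩

namespace GMTLSpace

/-- The universe of the GMTL-algebra dual to `X`: the nonempty clopen up-sets. -/
def duals (X : GMTLSpace.{u}) : Set (Set X) :=
  {V | IsClopen V ∧ IsUpperSet V ∧ V.Nonempty}

/-- Morphisms: bounded morphisms that preserve the greatest element. -/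
def IsMorphism (X Z : GMTLSpace.{u}) (f : X → Z) : Prop :=
  ResSpace.IsBoundedMorphism X.toResSpace Z.toResSpace f ∧ f X.greatest = Z.greatest

/-- `e : B × 𝒜(X) → 𝒜(X)` is an external join, where `𝒜(X)` is the GMTL-algebra of nonempty
clopen up-sets of `X` with the operations `∩`, `∪`, `R[-, -, ·]`, `→` and unit `X`. -/
structure IsExternalJoin (X : GMTLSpace.{u}) {B : Type u} [BooleanAlgebra B]
    (e : B → Set X → Set X) : Prop where
  mapsTo : ∀ b, ∀ V ∈ X.duals, e b V ∈ X.duals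
  -- (V1): each `e b` is an endomorphism
  left_inf : ∀ b, ∀ V ∈ X.duals, ∀ W ∈ X.duals, e b (V ∩ W) = e b V ∩ e b W
  left_sup : ∀ b, ∀ V ∈ X.duals, ∀ W ∈ X.duals, e b (V ∪ W) = e b V ∪ e b W
  left_mul : ∀ b, ∀ V ∈ X.duals, ∀ W ∈ X.duals, e b (X.mul V W) = X.mul (e b V) (e b W)
  left_imp : ∀ b, ∀ V ∈ X.duals, ∀ W ∈ X.duals, e b (X.imp V W) = X.imp (e b V) (e b W)
  left_one : ∀ b, e b univ = univ
  -- (V1): each `fun b => e b V` is a lattice homomorphism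
  right_inf : ∀ b c, ∀ V ∈ X.duals, e (b ⊓ c) V = e b V ∩ e c V
  right_sup : ∀ b c, ∀ V ∈ X.duals, e (b ⊔ c) V = e b V ∪ e c V
  -- (V2)
  bot_left : ∀ V ∈ X.duals, e ⊥ V = V
  top_left : ∀ V ∈ X.duals, e ⊤ V = univ
  -- (V3)
  sup_sup : ∀ b c, ∀ V ∈ X.duals, ∀ W ∈ X.duals, e b V ∪ e c W = e (b ⊔ c) (V ∪ W)
  sup_comp : ∀ b c, ∀ V ∈ X.duals, ∀ W ∈ X.duals, e (b ⊔ c) (V ∪ W) = e b (e c (V ∪ W))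

end GMTLSpace

/-! ## Dual quadruples and the rotation construction -/

/-- Dual quadruples `(S, X, Υ, Δ)`. -/
structure DualQuadruple : Type (u + 1) where
  S : Type u
  [topS : TopologicalSpace S]
  [compactS : CompactSpace S]
  [t2S : T2Space S]
  [tdS : TotallyDisconnectedSpace S]
  X : GMTLSpace.{u}
  υ : Clopens S → X → X
  isMorphism_υ : ∀ U, X.IsMorphism X (υ U)
  isExternalJoin : X.IsExternalJoin (fun (U : Clopens S) (V : Set X) => υ U ⁻¹' V)
  Δ : ClosureOperator X
  continuous_Δ : Continuous Δ
  map_R_Δ : ∀ x y z : X, X.R x y z → X.R (Δ x) (Δ y) (Δ z)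

attribute [instance] DualQuadruple.topS DualQuadruple.compactS DualQuadruple.t2S
  DualQuadruple.tdS

namespace DualQuadruple

variable (Q : DualQuadruple.{u})

/-- `s` fixes `x`: every `υ_U` with `s ∉ U` clopen fixes `x`. -/
def Fixes (s : Q.S) (x : Q.X) : Prop := ∀ U : Clopens Q.S, s ∉ U → Q.υ U x = x

/-- `D = {(s, x) : s fixes x}`. -/
def Lower : Type u := {p : Q.S × Q.X // Q.Fixes p.1 p.2}

/-- `D^∂ = {+(s, Δ x) : s fixes x, Δ x ≠ ⊤}`. -/
def Upper : Type u :=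
  {p : Q.S × Q.X // (∃ x, Q.Fixes p.1 x ∧ p.2 = Q.Δ x) ∧ p.2 ≠ Q.X.greatest}

/-- The carrier: the disjoint union of `D` and `D^∂`. -/
inductive Point : Type u
  | low : Q.Lower → Point
  | up : Q.Upper → Point

variable {Q}

/-- The order `⊑`. -/
def Point.le : Q.Point → Q.Point → Prop
  | .low p, .low q => p.1.1 = q.1.1 ∧ p.1.2 ≤ q.1.2
  | .up p, .up q => p.1.1 = q.1.1 ∧ q.1.2 ≤ p.1.2
  | .low p, .up q => p.1.1 = q.1.1
  | .up _, .low _ => False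

instance : PartialOrder Q.Point where
  le := Point.le
  le_refl p := by cases p <;> simp [Point.le]
  le_trans p q r := by
    cases p <;> cases q <;> cases r <;> simp only [Point.le] <;> intro h1 h2
    · exact ⟨h1.1.trans h2.1, h1.2.trans h2.2⟩
    · exact h1.1.trans h2
    · exact h2.elim
    · exact h1.trans h2.1
    · exact h1.elim
    · exact h1.elim
    · exact h2.elim
    · exact ⟨h1.1.trans h2.1, h2.2.trans h1.2⟩
  le_antisymm p q := by
    cases p <;> cases q <;> simp only [Point.le] <;> intro h1 h2
    · congr 1; exact Subtype.ext (Prod.ext h1.1 (le_antisymm h1.2 h2.2))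
    · exact h2.elim
    · exact h1.elim
    · congr 1; exact Subtype.ext (Prod.ext h1.1 (le_antisymm h2.2 h1.2))

variable (Q) in
/-- `W_(U,V) = [(U × V) ∪ +(U × Δ[X] ∪ S × Δ[V]ᶜ)] ∩ T`. -/
def W (U : Clopens Q.S) (V : Set Q.X) : Set Q.Point :=
  {t | match t with
    | .low p => p.1.1 ∈ U ∧ p.1.2 ∈ V
    | .up p => p.1.1 ∈ U ∨ p.1.2 ∉ Q.Δ '' V}

instance : TopologicalSpace Q.Point :=
  generateFrom {s | ∃ U : Clopens Q.S, ∃ V ∈ Q.X.duals, s = Q.W U V ∨ s = (Q.W U V)ᶜ}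

/-- The graph of the partial operation `∘`: `IsCirc p q r` says that `p ∘ q` is defined and
equal to `r`. Here `x • y` is the least `z` with `R(x, y, z)`, and `x ⇒ w` is the greatest `z`
with `R(z, x, w)`. -/
def IsCirc : Q.Point → Q.Point → Q.Point → Prop
  | .low p, .low q, .low r =>
      p.1.1 = q.1.1 ∧ r.1.1 = p.1.1 ∧ IsLeast {z | Q.X.R p.1.2 q.1.2 z} r.1.2
  | .low p, .up q, .up r =>
      p.1.1 = q.1.1 ∧ r.1.1 = p.1.1 ∧ p.1.2 ≤ Q.Δ q.1.2 ∧
        IsGreatest {z | Q.X.R z p.1.2 (Q.Δ q.1.2)} r.1.2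
  | .up q, .low p, .up r =>
      p.1.1 = q.1.1 ∧ r.1.1 = p.1.1 ∧ p.1.2 ≤ Q.Δ q.1.2 ∧
        IsGreatest {z | Q.X.R z p.1.2 (Q.Δ q.1.2)} r.1.2
  | _, _, _ => False

/-- `∘` is single-valued. -/
theorem IsCirc.unique {p q r r' : Q.Point} (h : IsCirc p q r) (h' : IsCirc p q r') :
    r = r' := by
  cases p <;> cases q <;> cases r <;> cases r' <;> simp only [IsCirc] at h h'
  · congr 1; exact Subtype.ext (Prod.ext (h.2.1.trans h'.2.1.symm) (h.2.2.unique h'.2.2))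
  · congr 1; exact Subtype.ext (Prod.ext (h.2.1.trans h'.2.1.symm) (h.2.2.2.unique h'.2.2.2))
  · congr 1; exact Subtype.ext (Prod.ext (h.2.1.trans h'.2.1.symm) (h.2.2.2.unique h'.2.2.2))

variable (Q) in
/-- The space `S ⊗ X` constructed from a dual quadruple; `R(p, q, r)` says that `p ∘ q` exists
and `p ∘ q ⊑ r`. -/
def tensor : ResSpace.{u} where
  carrier := Q.Point
  R p q r := ∃ t, IsCirc p q t ∧ t ≤ r
  E := univ

end DualQuadruple

/-! ## Spaces of prime filters -/

section Spectra

variable {A : Type u} [MTLAlgebra A]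

/-- `F` is a generalized prime filter of the sublattice `L` of `A`
(a prime filter of `L`, or `L` itself). -/
structure IsGenPrimeFilter (L F : Set A) : Prop where
  subset : F ⊆ L
  nonempty : F.Nonempty
  upper : ∀ a ∈ F, ∀ b ∈ L, a ≤ b → b ∈ F
  inf_mem : ∀ a ∈ F, ∀ b ∈ F, a ⊓ b ∈ F
  prime : ∀ a ∈ L, ∀ b ∈ L, a ⊔ b ∈ F → a ∈ F ∨ b ∈ F

/-- `F` is a (proper) prime filter of the sublattice `L` of `A`. -/
structure IsPrimeFilter (L F : Set A) : Prop extends IsGenPrimeFilter L F where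
  proper : F ≠ L

/-- The topology generated by the sets `{F : a ∈ F}`, `a ∈ L`, and their complements. -/
abbrev filterTopology (L : Set A) (P : Set A → Prop) : TopologicalSpace {F : Set A // P F} :=
  generateFrom {s | ∃ a ∈ L, s = {F : {F : Set A // P F} | a ∈ F.1} ∨
    s = {F : {F : Set A // P F} | a ∈ F.1}ᶜ}

/-- `F • G`, the up-set (in `L`) of the complex product. -/
def filterMul (L F G : Set A) : Set A := {c | c ∈ L ∧ ∃ a ∈ F, ∃ b ∈ G, a * b ≤ c}

variable (A)

/-- The extended Priestley dual of an MTL-algebra. -/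
def dualSpace : ResSpace.{u} where
  carrier := {F : Set A // IsPrimeFilter univ F}
  topology := filterTopology univ _
  order := inferInstance
  R F G H := filterMul univ F.1 G.1 ⊆ H.1
  E := {F | (1 : A) ∈ F.1}

/-- The Stone space of the Boolean skeleton. -/
def StoneDual : Type u := {F : Set A // IsPrimeFilter (boolSkeleton A) F}

instance : TopologicalSpace (StoneDual A) := filterTopology (boolSkeleton A) _

/-- The extended Priestley dual of the radical, on the generalized prime filters. -/
def radicalDual : ResSpace.{u} where
  carrier := {F : Set A // IsGenPrimeFilter (radical A) F}
  topology := filterTopology (radical A) _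
  order := inferInstance
  R F G H := filterMul (radical A) F.1 G.1 ⊆ H.1
  E := {F | (1 : A) ∈ F.1}

end Spectra

end SBPDual

/-! Everything rests on a normal form: each element of an SBP-algebra is `(b ⊓ r) ⊔ (neg b ⊓ neg r)`
with `b` complemented and `r` in the radical (`exists_decomposition`). The radical consists of the
`r` with `neg r * neg r = ⊥` (`mem_radical_iff`), and negations of radical elements lie below all
radical elements (`neg_le_of_mem`).

A prime filter `F` of `A` is therefore known from its trace `s` on the Boolean skeleton and from the
elements `r` and `neg r`, `r` radical, that it contains. If `F` contains no `neg r`, it is generated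
by `s` and `x = F ∩ radical A`. Otherwise it contains the whole radical and is generated by `s` and
the `neg r` with `r` outside `y = {r | neg r ∉ F}`; this `y` is proper, closed under the
double-negation operator, and shrinks as `F` grows. Primeness of `F` says that `s` fixes `x`,
respectively `y`. Conversely every such pair generates a prime filter (`isPrimeFilter_lowFilter`,
`IsUpperPair.isPrimeFilter_upFilter`), so the points of the rotation are exactly the prime filters
(`toFilter_le_iff`, `toFilter_surjective`).

The set `W_(U,V)` with `V` given by `r` corresponds to the element in normal form with data `(u, r)`
(`mem_W_iff`), which matches the topologies. For the ternary relation, the product of two lower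
filters is the product of their radical parts; a lower and an upper one multiply by `p * neg q = neg
(p ⇨ neg (neg q))` (`mul_neg_eq`), which is the residual `⇒`; two upper ones have `⊥` in their
product, so nothing is related to them. -/

namespace SBPDual

open Set TopologicalSpace

/-! ### Arithmetic of MTL-algebras. -/

section MTL

variable {A : Type u} [MTLAlgebra A] {a b c d : A}

theorem mul_le_iff : a * b ≤ c ↔ b ≤ a ⇨ c := MTLAlgebra.mul_le_iff_le_himp a b c

theorem mul_le_iff' : a * b ≤ c ↔ a ≤ b ⇨ c := by rw [mul_comm, mul_le_iff]

theorem mul_mono (h : a ≤ b) (h' : c ≤ d) : a * c ≤ b * d :=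
  (mul_le_iff'.2 (h.trans (mul_le_iff'.1 le_rfl))).trans
    (mul_le_iff.2 (h'.trans (mul_le_iff.1 le_rfl)))

theorem mul_le_left' : a * b ≤ a := by
  simpa using mul_mono (le_refl a) (MTLAlgebra.le_one b)

theorem mul_le_right' : a * b ≤ b := by
  simpa using mul_mono (MTLAlgebra.le_one a) (le_refl b)

theorem mul_le_inf' : a * b ≤ a ⊓ b := le_inf mul_le_left' mul_le_right'

theorem eq_one (h : 1 ≤ a) : a = 1 := le_antisymm (MTLAlgebra.le_one a) h

theorem mul_himp_le : a * (a ⇨ b) ≤ b := mul_le_iff.2 le_rfl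

theorem le_himp : b ≤ a ⇨ b := mul_le_iff.1 mul_le_right'

theorem mul_sup' : a * (b ⊔ c) = a * b ⊔ a * c :=
  le_antisymm (mul_le_iff.2 (sup_le (mul_le_iff.1 le_sup_left) (mul_le_iff.1 le_sup_right)))
    (sup_le (mul_mono le_rfl le_sup_left) (mul_mono le_rfl le_sup_right))

theorem sup_mul' : (b ⊔ c) * a = b * a ⊔ c * a := by
  rw [mul_comm, mul_sup', mul_comm a, mul_comm a]

theorem mul_bot' : a * (⊥ : A) = ⊥ := le_bot_iff.1 mul_le_right'

theorem himp_mono (h : b ≤ c) : a ⇨ b ≤ a ⇨ c := mul_le_iff.1 (mul_himp_le.trans h)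

theorem himp_anti (h : a ≤ b) : b ⇨ c ≤ a ⇨ c :=
  mul_le_iff.1 ((mul_mono h le_rfl).trans mul_himp_le)

/-- Reasoning by cases from prelinearity. -/
theorem le_of_cases (a b : A) (h₁ : (a ⇨ b) * c ≤ d) (h₂ : (b ⇨ a) * c ≤ d) : c ≤ d := by
  have := sup_le h₁ h₂
  rwa [← sup_mul', MTLAlgebra.prelinear, one_mul] at this

/-- Prelinearity is needed: after multiplication by `b ⇨ c` the factor `b` falls below `b ⊓ c`, and
symmetrically for `c ⇨ b`. -/
theorem mul_inf' : a * (b ⊓ c) = a * b ⊓ a * c := by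
  refine le_antisymm (le_inf (mul_mono le_rfl inf_le_left) (mul_mono le_rfl inf_le_right)) ?_
  refine le_of_cases b c ?_ ?_
  · refine (mul_mono le_rfl inf_le_left).trans ?_
    rw [mul_left_comm, mul_comm (b ⇨ c)]
    exact mul_mono le_rfl (le_inf mul_le_left' mul_himp_le)
  · refine (mul_mono le_rfl inf_le_right).trans ?_
    rw [mul_left_comm, mul_comm (c ⇨ b)]
    exact mul_mono le_rfl (le_inf mul_himp_le mul_le_left')

/-- Again by prelinearity. This identity is what makes products of prime filters prime. -/
theorem himp_sup : a ⇨ (b ⊔ c) = (a ⇨ b) ⊔ (a ⇨ c) := by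
  refine le_antisymm ?_ (sup_le (himp_mono le_sup_left) (himp_mono le_sup_right))
  refine le_of_cases b c ?_ ?_
  · refine le_sup_of_le_right (mul_le_iff.1 ?_)
    rw [mul_left_comm]
    refine (mul_mono le_rfl mul_himp_le).trans ?_
    rw [mul_sup', mul_comm, sup_le_iff]
    exact ⟨mul_himp_le, mul_le_right'⟩
  · refine le_sup_of_le_left (mul_le_iff.1 ?_)
    rw [mul_left_comm]
    refine (mul_mono le_rfl mul_himp_le).trans ?_
    rw [mul_sup', mul_comm _ c, sup_le_iff]
    exact ⟨mul_le_right', mul_himp_le⟩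

theorem himp_inf : a ⇨ (b ⊓ c) = (a ⇨ b) ⊓ (a ⇨ c) :=
  le_antisymm (le_inf (himp_mono inf_le_left) (himp_mono inf_le_right))
    (mul_le_iff.1 (le_inf ((mul_mono le_rfl inf_le_left).trans mul_himp_le)
      ((mul_mono le_rfl inf_le_right).trans mul_himp_le)))

theorem le_neg_iff : a ≤ neg b ↔ b * a = ⊥ := by
  rw [neg, ← mul_le_iff, le_bot_iff]

theorem le_neg_comm : a ≤ neg b ↔ b ≤ neg a := by
  rw [le_neg_iff, le_neg_iff, mul_comm]

theorem le_neg_neg : a ≤ neg (neg a) := le_neg_comm.1 le_rfl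

theorem neg_anti (h : a ≤ b) : neg b ≤ neg a := himp_anti h

theorem neg_neg_neg : neg (neg (neg a)) = neg a :=
  le_antisymm (neg_anti le_neg_neg) le_neg_neg

theorem mul_neg : a * neg a = ⊥ := le_neg_iff.1 le_rfl

theorem neg_one : neg (1 : A) = ⊥ := by simpa using mul_neg (a := (1 : A))

theorem neg_bot : neg (⊥ : A) = 1 :=
  eq_one (le_neg_iff.2 (by rw [mul_comm, mul_bot']))

theorem neg_sup : neg (a ⊔ b) = neg a ⊓ neg b := by
  refine le_antisymm (le_inf (neg_anti le_sup_left) (neg_anti le_sup_right)) ?_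
  rw [le_neg_comm]
  exact sup_le (le_neg_comm.1 inf_le_left) (le_neg_comm.1 inf_le_right)

theorem neg_inf : neg (a ⊓ b) = neg a ⊔ neg b := by
  refine le_antisymm ?_ (sup_le (neg_anti inf_le_left) (neg_anti inf_le_right))
  refine le_of_cases a b ?_ ?_
  · refine le_sup_of_le_left (le_neg_iff.2 (le_bot_iff.1 ?_))
    rw [← mul_assoc]
    exact (mul_mono (le_inf mul_le_left' mul_himp_le) le_rfl).trans mul_neg.le
  · refine le_sup_of_le_right (le_neg_iff.2 (le_bot_iff.1 ?_))
    rw [← mul_assoc]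
    exact (mul_mono (le_inf mul_himp_le mul_le_left') le_rfl).trans mul_neg.le

theorem mul_neg_neg_eq_bot (h : a * b = ⊥) : a * neg (neg b) = ⊥ := by
  rwa [mul_comm, ← le_neg_iff, neg_neg_neg, le_neg_iff, mul_comm]

theorem neg_neg_mul_le : neg (neg a) * neg (neg b) ≤ neg (neg (a * b)) := by
  rw [le_neg_iff, ← mul_assoc]
  apply mul_neg_neg_eq_bot
  rw [mul_right_comm]
  apply mul_neg_neg_eq_bot
  rw [mul_right_comm, mul_assoc, mul_comm, mul_neg]

/-- By prelinearity the mixed term `a * b` lies below `a * a ⊔ b * b`. Consequently a join equal to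
`1` may be squared termwise. -/
theorem sq_sup : (a ⊔ b) * (a ⊔ b) = a * a ⊔ b * b := by
  have key : a * b ≤ a * a ⊔ b * b := by
    refine le_of_cases a b ?_ ?_
    · rw [← mul_assoc, mul_comm _ a]
      exact (mul_mono mul_himp_le le_rfl).trans le_sup_right
    · rw [mul_left_comm, mul_comm _ b]
      exact (mul_mono le_rfl mul_himp_le).trans le_sup_left
  rw [mul_sup', sup_mul', sup_mul', mul_comm b a]
  exact le_antisymm (sup_le (sup_le le_sup_left key) (sup_le key le_sup_right))
    (sup_le (le_sup_of_le_left le_sup_left) (le_sup_of_le_right le_sup_right))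

theorem sq_sup_eq_one (h : a ⊔ b = 1) : a * a ⊔ b * b = 1 := by
  rw [← sq_sup, h, one_mul]

theorem oplus_mono (h : a ≤ b) : oplus a a ≤ oplus b b :=
  neg_anti (mul_mono (neg_anti h) (neg_anti h))

theorem le_oplus : a ≤ oplus a a :=
  le_neg_neg.trans (neg_anti mul_le_left')

theorem oplus_eq_one : oplus a a = 1 ↔ neg a * neg a = ⊥ := by
  constructor
  · intro h
    have := le_neg_iff.1 h.ge
    simpa using this
  · intro h
    rw [oplus, h, neg_bot]

/-! ### Complemented elements -/

theorem boolSkeleton_iff : b ∈ boolSkeleton A ↔ b ⊔ neg b = 1 := by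
  constructor
  · rintro ⟨c, h, h'⟩
    refine eq_one (h ▸ sup_le_sup_left (le_neg_iff.2 (le_bot_iff.1 ?_)) b)
    exact mul_le_inf'.trans h'.le
  · intro h
    refine ⟨neg b, h, le_bot_iff.1 ?_⟩
    have : b ⊓ neg b = (b ⊓ neg b) * (b ⊔ neg b) := by rw [h, mul_one]
    rw [this, mul_sup']
    refine sup_le ((mul_mono inf_le_right le_rfl).trans ?_) ((mul_mono inf_le_left le_rfl).trans ?_)
    · rw [mul_comm, mul_neg]
    · rw [mul_neg]

/-- Split `b ⊓ a` along `b ⊔ neg b = 1`: the `neg b` component is killed by `b`. -/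
theorem mul_eq_inf (h : b ∈ boolSkeleton A) : b * a = b ⊓ a := by
  refine le_antisymm mul_le_inf' ?_
  have h1 := boolSkeleton_iff.1 h
  have : b ⊓ a = (b ⊔ neg b) * (b ⊓ a) := by rw [h1, one_mul]
  rw [this, sup_mul']
  refine sup_le (mul_mono le_rfl inf_le_right) ((mul_mono le_rfl inf_le_left).trans ?_)
  rw [mul_comm, mul_neg]; exact bot_le

theorem inf_neg (h : b ∈ boolSkeleton A) : b ⊓ neg b = ⊥ := by
  rw [← mul_eq_inf h, mul_neg]

theorem neg_mem_boolSkeleton (h : b ∈ boolSkeleton A) : neg b ∈ boolSkeleton A :=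
  ⟨b, by rw [sup_comm, boolSkeleton_iff.1 h], by rw [inf_comm, inf_neg h]⟩

theorem neg_neg_of_mem (h : b ∈ boolSkeleton A) : neg (neg b) = b := by
  refine le_antisymm ?_ le_neg_neg
  have h1 : neg (neg b) = (b ⊔ neg b) * neg (neg b) := by rw [boolSkeleton_iff.1 h, one_mul]
  rw [h1, sup_mul', mul_neg]
  exact sup_le mul_le_left' bot_le

theorem one_mem_boolSkeleton : (1 : A) ∈ boolSkeleton A :=
  ⟨⊥, sup_of_le_left bot_le, inf_of_le_right bot_le⟩

theorem bot_mem_boolSkeleton : (⊥ : A) ∈ boolSkeleton A :=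
  ⟨1, sup_of_le_right bot_le, inf_of_le_left bot_le⟩

theorem sup_mem_boolSkeleton (h : b ∈ boolSkeleton A) (h' : c ∈ boolSkeleton A) :
    b ⊔ c ∈ boolSkeleton A := by
  rw [boolSkeleton_iff, neg_sup, sup_inf_left]
  refine eq_one (le_inf ?_ ?_)
  · rw [← boolSkeleton_iff.1 h]; exact sup_le_sup_right le_sup_left _
  · rw [← boolSkeleton_iff.1 h']; exact sup_le_sup_right le_sup_right _

theorem inf_mem_boolSkeleton (h : b ∈ boolSkeleton A) (h' : c ∈ boolSkeleton A) :
    b ⊓ c ∈ boolSkeleton A := by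
  rw [boolSkeleton_iff, neg_inf, sup_inf_right]
  refine eq_one (le_inf ?_ ?_)
  · rw [← boolSkeleton_iff.1 h]; exact sup_le_sup_left le_sup_left _
  · rw [← boolSkeleton_iff.1 h']; exact sup_le_sup_left le_sup_right _

theorem inf_le_iff_of_mem (h : b ∈ boolSkeleton A) : b ⊓ a ≤ c ↔ a ≤ neg b ⊔ c := by
  constructor
  · intro h1
    have : a = (b ⊔ neg b) * a := by rw [boolSkeleton_iff.1 h, one_mul]
    rw [this, sup_mul', mul_eq_inf h]
    exact sup_le (le_sup_of_le_right h1) (le_sup_of_le_left mul_le_left')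
  · intro h1
    refine (inf_le_inf_left b h1).trans ?_
    rw [inf_sup_left, inf_neg h]
    exact sup_le bot_le inf_le_right

theorem neg_inf_le_iff_of_mem (h : b ∈ boolSkeleton A) : neg b ⊓ a ≤ c ↔ a ≤ b ⊔ c := by
  rw [inf_le_iff_of_mem (neg_mem_boolSkeleton h), neg_neg_of_mem h]

/-- Idempotence of `b` absorbs the mixed terms. With `sup_himp_sup`, this makes joining with `b` an
endomorphism of the radical, the source of the maps `υ`. -/
theorem sup_mul_sup (h : b ∈ boolSkeleton A) : (b ⊔ a) * (b ⊔ c) = b ⊔ a * c := by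
  rw [mul_sup', sup_mul', sup_mul', mul_eq_inf h, inf_idem]
  refine le_antisymm ?_ ?_
  · exact sup_le (sup_le le_sup_left (le_sup_of_le_left mul_le_right'))
      (sup_le (le_sup_of_le_left mul_le_left') le_sup_right)
  · exact sup_le (le_sup_of_le_left le_sup_left) (le_sup_of_le_right le_sup_right)

theorem sup_himp_sup (h : b ∈ boolSkeleton A) : (b ⊔ a) ⇨ (b ⊔ c) = b ⊔ (a ⇨ c) := by
  refine le_antisymm ?_ (mul_le_iff.1 ?_)
  · rw [← neg_inf_le_iff_of_mem h, ← mul_eq_inf (neg_mem_boolSkeleton h), ← mul_le_iff,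
      mul_left_comm, mul_eq_inf (neg_mem_boolSkeleton h), neg_inf_le_iff_of_mem h]
    exact (mul_mono le_sup_right le_rfl).trans mul_himp_le
  · rw [sup_mul_sup h]
    exact sup_le_sup_left mul_himp_le _

end MTL

/-! ### The radical of an SBP-algebra and the normal form of its elements. -/

section SBP

variable {A : Type u} [SBPAlgebra A] {a b c r r' : A}

/-- The complemented element above which `a` lies in the radical. -/
theorem oplus_sq_mem_boolSkeleton : oplus (a * a) (a * a) ∈ boolSkeleton A := by
  rw [boolSkeleton_iff]
  -- The squares of `a ⇨ neg a` and `neg a ⇨ a` join to `1`. Since `a ⇨ neg a ≤ neg (a * a)` and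
  -- `neg a ⇨ a ≤ oplus a a`, they lie below `neg b` and `b` for `b = oplus (a * a) (a * a)`; the
  -- second bound uses `oplus_sq`.
  have h1 := sq_sup_eq_one (MTLAlgebra.prelinear a (neg a))
  refine eq_one (h1 ▸ sup_le (le_sup_of_le_right ?_) (le_sup_of_le_left ?_))
  · have : (a ⇨ neg a) ≤ neg (a * a) := by
      rw [le_neg_iff, ← le_bot_iff, mul_assoc]
      exact (mul_mono le_rfl mul_himp_le).trans mul_neg.le
    exact (mul_mono this this).trans le_neg_neg
  · rw [← SBPAlgebra.oplus_sq]
    have : (neg a ⇨ a) ≤ oplus a a := by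
      rw [oplus, le_neg_iff, ← le_bot_iff, mul_assoc]
      refine (mul_mono le_rfl mul_himp_le).trans ?_
      rw [mul_comm, mul_neg]
    exact mul_mono this this

/-- The elements `a` with `2a = 1`. -/
def IsLarge (a : A) : Prop := neg a * neg a = ⊥

theorem IsLarge.mono (h : IsLarge a) (h' : a ≤ b) : IsLarge b :=
  le_bot_iff.1 ((mul_mono (neg_anti h') (neg_anti h')).trans (le_of_eq h))

theorem isLarge_one : IsLarge (1 : A) := by rw [IsLarge, neg_one, mul_bot']

theorem IsLarge.sq (h : IsLarge a) : IsLarge (a * a) := by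
  rw [IsLarge, ← oplus_eq_one] at *
  rw [← SBPAlgebra.oplus_sq, h, one_mul]

theorem IsLarge.inf (h : IsLarge a) (h' : IsLarge b) : IsLarge (a ⊓ b) := by
  rw [IsLarge] at *
  rw [neg_inf, sq_sup, h, h', sup_bot_eq]

theorem IsLarge.mul (h : IsLarge a) (h' : IsLarge b) : IsLarge (a * b) :=
  (h.inf h').sq.mono (mul_mono inf_le_left inf_le_right)

theorem IsLarge.pow (h : IsLarge a) (n : ℕ) : IsLarge (a ^ n) := by
  induction n with
  | zero => rw [pow_zero]; exact isLarge_one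
  | succ n ih => rw [pow_succ]; exact ih.mul h

/-- The axiom `oplus_sq` at `a * a` says that `oplus (a * a) (a * a)` has square `⊥`. Being
complemented it is idempotent, hence `⊥`, and it dominates `a * a`. -/
theorem sq_eq_bot_of_pow_four (h : (a * a) * (a * a) = ⊥) : a * a = ⊥ := by
  have h1 := SBPAlgebra.oplus_sq (a * a)
  have h2 : oplus (⊥ : A) ⊥ = ⊥ := by rw [oplus, neg_bot, one_mul, neg_one]
  rw [h, h2, mul_eq_inf oplus_sq_mem_boolSkeleton, inf_idem] at h1
  exact le_bot_iff.1 (h1 ▸ le_oplus)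

theorem sq_eq_bot_of_pow {n : ℕ} (h : a ^ n = ⊥) : a * a = ⊥ := by
  have h2 : ∀ k : ℕ, a ^ (2 ^ (k + 1)) = ⊥ → a * a = ⊥ := by
    intro k
    induction k with
    | zero => intro h; rwa [zero_add, pow_one, pow_two] at h
    | succ k ih =>
      intro h
      apply ih
      rw [pow_succ, pow_mul, pow_two] at h ⊢
      apply sq_eq_bot_of_pow_four
      rw [pow_succ, pow_mul, pow_two] at h
      exact h
  apply h2 n
  -- Raising the exponent to a power of two allows repeated halving.
  have : n ≤ 2 ^ (n + 1) := (Nat.lt_two_pow_self.le).trans (Nat.pow_le_pow_right (by simp) (by simp))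
  obtain ⟨k, hk⟩ := Nat.exists_eq_add_of_le this
  rw [hk, pow_add, h, mul_comm, mul_bot']

variable (A) in
theorem isDeductiveFilter_singleton : IsDeductiveFilter A {1} where
  one_mem := rfl
  upper := fun _ _ hxy hx => eq_one (mem_singleton_iff.1 hx ▸ hxy)
  mul_mem := by simp

/-- The deductive filter generated by `F` and `a`. -/
theorem isDeductiveFilter_adjoin {F : Set A} (hF : IsDeductiveFilter A F) (a : A) :
    IsDeductiveFilter A {c | ∃ m ∈ F, ∃ n : ℕ, m * a ^ n ≤ c} where
  one_mem := ⟨1, hF.one_mem, 0, by simp⟩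
  upper := fun x y hxy ⟨m, hm, n, h⟩ => ⟨m, hm, n, h.trans hxy⟩
  mul_mem := by
    rintro x ⟨m, hm, n, h⟩ y ⟨m', hm', n', h'⟩
    refine ⟨m * m', hF.mul_mem _ hm _ hm', n + n', ?_⟩
    rw [pow_add, mul_mul_mul_comm]
    exact mul_mono h h'

theorem IsDeductiveFilter.eq_univ {F : Set A} (hF : IsDeductiveFilter A F) (h : ⊥ ∈ F) :
    F = univ := eq_univ_of_forall fun _ => hF.upper bot_le h

theorem exists_maximal_deductiveFilter {F : Set A} (hF : IsDeductiveFilter A F)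
    (h : F ≠ univ) :
    ∃ M, F ⊆ M ∧ Maximal (fun G => IsDeductiveFilter A G ∧ G ≠ univ) M := by
  refine zorn_subset_nonempty {G | IsDeductiveFilter A G ∧ G ≠ univ} ?_ F ⟨hF, h⟩
  intro C hC hchain hne
  refine ⟨⋃₀ C, ⟨⟨?_, ?_, ?_⟩, ?_⟩, fun s hs => subset_sUnion_of_mem hs⟩
  · obtain ⟨G, hG⟩ := hne
    exact ⟨G, hG, (hC hG).1.one_mem⟩
  · rintro x y hxy ⟨G, hG, hx⟩
    exact ⟨G, hG, (hC hG).1.upper hxy hx⟩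
  · rintro x ⟨G, hG, hx⟩ y ⟨G', hG', hy⟩
    rcases hchain.total hG hG' with h1 | h1
    · exact ⟨G', hG', (hC hG').1.mul_mem _ (h1 hx) _ hy⟩
    · exact ⟨G, hG, (hC hG).1.mul_mem _ hx _ (h1 hy)⟩
  · intro h1
    obtain ⟨G, hG, hb⟩ : (⊥ : A) ∈ ⋃₀ C := h1 ▸ mem_univ _
    exact (hC hG).2 ((hC hG).1.eq_univ hb)

/-- If `a` is not large, `neg a` is not nilpotent by `sq_eq_bot_of_pow`, so some maximal filter
contains `neg a` and hence omits `a`. Conversely, a maximal filter that omits `a` contains some `neg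
(a ^ n)`; for large `a` this has square `⊥`, which is absurd. -/
theorem mem_radical_iff : a ∈ radical A ↔ IsLarge a := by
  constructor
  · intro h
    by_contra h1
    have hF : IsDeductiveFilter A {c | ∃ m ∈ ({1} : Set A), ∃ n : ℕ, m * (neg a) ^ n ≤ c} :=
      isDeductiveFilter_adjoin (isDeductiveFilter_singleton A) _
    obtain ⟨M, hFM, hM⟩ := exists_maximal_deductiveFilter hF (by
      intro h2
      obtain ⟨m, rfl, n, h3⟩ := h2.ge (mem_univ ⊥)
      rw [one_mul, le_bot_iff] at h3
      exact h1 (sq_eq_bot_of_pow h3))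
    have ha := h M hM
    have hna : neg a ∈ M := hFM ⟨1, rfl, 1, by simp⟩
    exact hM.1.2 (hM.1.1.eq_univ (mul_neg (a := a) ▸ hM.1.1.mul_mem _ ha _ hna))
  · intro h M hM
    by_contra ha
    have hF := isDeductiveFilter_adjoin hM.1.1 a
    have hu : {c | ∃ m ∈ M, ∃ n : ℕ, m * a ^ n ≤ c} = univ := by
      by_contra hne
      have := hM.2 ⟨hF, hne⟩ (fun m hm => ⟨m, hm, 0, by simp⟩)
      exact ha (this ⟨1, hM.1.1.one_mem, 1, by simp⟩)
    obtain ⟨m, hm, n, h3⟩ := hu.ge (mem_univ ⊥)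
    rw [mul_comm, le_bot_iff, ← le_neg_iff] at h3
    have h4 := hM.1.1.upper h3 hm
    have h5 := hM.1.1.mul_mem _ h4 _ h4
    rw [h.pow n] at h5
    exact hM.1.2 (hM.1.1.eq_univ h5)

variable (A) in
theorem isDeductiveFilter_radical : IsDeductiveFilter A (radical A) where
  one_mem := mem_radical_iff.2 isLarge_one
  upper := fun _ _ h h' => mem_radical_iff.2 ((mem_radical_iff.1 h').mono h)
  mul_mem := fun _ h _ h' => mem_radical_iff.2 ((mem_radical_iff.1 h).mul (mem_radical_iff.1 h'))

/-- Both factors lie below `neg (r ⊓ r')`, and `r ⊓ r'` is large. -/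
theorem neg_mul_neg_of_mem (h : r ∈ radical A) (h' : r' ∈ radical A) : neg r * neg r' = ⊥ :=
  le_bot_iff.1 ((mul_mono (neg_anti inf_le_left) (neg_anti inf_le_right)).trans
    (le_of_eq ((mem_radical_iff.1 h).inf (mem_radical_iff.1 h'))))

/-- The fourth powers of `r ⇨ neg r'` and `neg r' ⇨ r` join to `1`. The square of the first is below
`neg (r * r)`, which itself has square `⊥`, so its fourth power vanishes and `neg r' ⇨ r = 1`. -/
theorem neg_le_of_mem (h : r ∈ radical A) (h' : r' ∈ radical A) : neg r' ≤ r := by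
  have h1 := sq_sup_eq_one (sq_sup_eq_one (MTLAlgebra.prelinear r (neg r')))
  have h2 : (r ⇨ neg r') * (r ⇨ neg r') ≤ neg (r * r) := by
    rw [le_neg_iff, ← le_bot_iff, mul_mul_mul_comm, ← neg_mul_neg_of_mem h' h']
    exact mul_mono mul_himp_le mul_himp_le
  have h3 := (mem_radical_iff.1 h).sq
  rw [le_bot_iff.1 ((mul_mono h2 h2).trans (le_of_eq h3)), bot_sup_eq] at h1
  have h4 : (neg r' ⇨ r) = 1 := eq_one (h1 ▸ mul_le_left'.trans mul_le_left')
  simpa using (mul_le_iff (a := neg r') (b := 1) (c := r)).2 h4.ge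

theorem eq_one_of_mem (h : b ∈ boolSkeleton A) (h' : b ∈ radical A) : b = 1 := by
  have h1 := mem_radical_iff.1 h'
  rw [IsLarge, mul_eq_inf (neg_mem_boolSkeleton h), inf_idem] at h1
  rw [← neg_neg_of_mem h, h1, neg_bot]

/-- A complemented element whose meet with the radical meets the negations of radical elements
vanishes. -/
theorem eq_bot_of_inf_le_neg (h : b ∈ boolSkeleton A) (hr : r ∈ radical A)
    (hr' : r' ∈ radical A) (hle : b ⊓ r ≤ neg r') : b = ⊥ := by
  -- Squaring the hypothesis gives `b * (r * r) = (b ⊓ r) * (b ⊓ r) ≤ neg r' * neg r' = ⊥`. Then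
  -- `neg b` is complemented and radical, hence `1`.
  have h1 : r * r ≤ neg b := by
    rw [le_neg_iff, ← le_bot_iff, ← neg_mul_neg_of_mem hr' hr']
    have : b * (r * r) = (b ⊓ r) * (b ⊓ r) := by
      rw [← mul_eq_inf h, mul_mul_mul_comm, mul_eq_inf h (a := b), inf_idem]
    rw [this]
    exact mul_mono hle hle
  have h2 := eq_one_of_mem (neg_mem_boolSkeleton h)
    ((isDeductiveFilter_radical A).upper h1 ((isDeductiveFilter_radical A).mul_mem _ hr _ hr))
  rw [← neg_neg_of_mem h, h2, neg_one]

theorem neg_neg_of_sq (h : a * a = ⊥) : neg (neg a) = a := by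
  refine le_antisymm ?_ le_neg_neg
  have h1 := SBPAlgebra.neg_sq_himp a
  rw [h, neg_bot] at h1
  simpa using mul_le_iff.2 (mul_le_iff.2 h1.ge)

variable (a) in
/-- Every element is determined by a complemented element and a radical element. -/
theorem exists_decomposition : ∃ b ∈ boolSkeleton A, ∃ r ∈ radical A,
    a = (b ⊓ r) ⊔ (neg b ⊓ neg r) := by
  -- The complemented part of `a` is `b = oplus (a * a) (a * a)`, which satisfies `a * a ≤ b ≤ oplus
  -- a a`.
  have hb := oplus_sq_mem_boolSkeleton (a := a)
  have hb' := SBPAlgebra.oplus_sq a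
  have hsq : a * a ≤ oplus (a * a) (a * a) := le_oplus
  have h1 : oplus (a * a) (a * a) ≤ oplus a a := hb' ▸ mul_le_left'
  generalize oplus (a * a) (a * a) = b at *
  have hnb := neg_mem_boolSkeleton hb
  -- On `neg b`, which lies below `neg (a * a)`, the axiom `neg_sq_himp` makes `a` involutive.
  have hnn : neg b ⊓ neg (neg a) ≤ a := by
    have h2 : neg b ≤ neg (neg a) ⇨ a := (neg_anti hsq).trans (by
      simpa using mul_le_iff.2 (SBPAlgebra.neg_sq_himp a).ge)
    rw [← mul_le_iff'] at h2
    rwa [← mul_eq_inf hnb]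
  have hp : neg b ⊔ a ∈ radical A := by
    rw [mem_radical_iff, IsLarge, ← oplus_eq_one]
    refine eq_one ((boolSkeleton_iff.1 hnb).ge.trans (sup_le ?_ ?_))
    · exact le_sup_left.trans le_oplus
    · rw [neg_neg_of_mem hb]
      exact h1.trans (oplus_mono le_sup_right)
  have hq : b ⊔ neg a ∈ radical A := by
    rw [mem_radical_iff, IsLarge, neg_sup, ← mul_eq_inf hnb, ← le_bot_iff, ← inf_neg hb, inf_comm]
    refine le_inf (mul_le_left'.trans mul_le_left') (le_trans ?_ hsq)
    rw [mul_eq_inf hnb]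
    exact mul_mono hnn hnn
  -- The radical part agrees with `a` on `b` and with `neg a` on `neg b`.
  refine ⟨b, hb, (neg b ⊔ a) ⊓ (b ⊔ neg a), ?_, ?_⟩
  · exact mem_radical_iff.2 ((mem_radical_iff.1 hp).inf (mem_radical_iff.1 hq))
  · apply le_antisymm
    · have : a = (b ⊔ neg b) * a := by rw [boolSkeleton_iff.1 hb, one_mul]
      conv_lhs => rw [this, sup_mul']
      refine sup_le (le_sup_of_le_left ?_) (le_sup_of_le_right ?_)
      · exact le_inf mul_le_left' (le_inf (mul_le_right'.trans le_sup_right)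
          (mul_le_left'.trans le_sup_left))
      · refine le_inf mul_le_left' ?_
        rw [neg_inf]
        refine le_sup_of_le_right ?_
        rw [neg_sup]
        exact mul_le_inf'.trans (inf_le_inf_left _ le_neg_neg)
    · refine sup_le ?_ ?_
      · rw [inf_le_iff_of_mem hb]
        exact inf_le_left
      · rw [neg_inf, inf_sup_left, neg_sup, neg_sup, neg_neg_of_mem hb]
        refine sup_le ?_ (inf_le_right.trans hnn)
        rw [← inf_assoc, inf_comm (neg b), inf_neg hb]
        exact inf_le_left.trans bot_le

end SBP

/-! ### Topology of spaces of filters. -/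

section FilterSpace

variable {A : Type u} {L : Set A} {P : Set A → Prop}

theorem isClopen_setOf_mem {a : A} (ha : a ∈ L) :
    @IsClopen _ (filterTopology L P) {F | a ∈ F.1} := by
  let := filterTopology L P
  refine ⟨⟨?_⟩, ?_⟩
  · exact isOpen_generateFrom_of_mem ⟨a, ha, Or.inr rfl⟩
  · exact isOpen_generateFrom_of_mem ⟨a, ha, Or.inl rfl⟩

theorem isUpperSet_setOf_mem (a : A) : IsUpperSet {F : {F // P F} | a ∈ F.1} :=
  fun _ _ h h' => h h'

theorem priestleySpace_filterTopology (hP : ∀ F, P F → F ⊆ L) :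
    @PriestleySpace {F // P F} _ (filterTopology L P) := by
  let := filterTopology L P
  refine ⟨fun {x y} hxy => ?_⟩
  obtain ⟨a, ha, ha'⟩ := not_subset.1 hxy
  exact ⟨_, isClopen_setOf_mem (hP _ x.2 ha), isUpperSet_setOf_mem a, ha, ha'⟩

/-- An ultrafilter of points converges to the set of elements that belong to almost all of them,
once this set is itself a point. -/
theorem compactSpace_filterTopology
    (hP : ∀ 𝒰 : Ultrafilter {F // P F}, P {a | a ∈ L ∧ {F : {F // P F} | a ∈ F.1} ∈ 𝒰}) :
    @CompactSpace {F // P F} (filterTopology L P) := by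
  let := filterTopology L P
  refine ⟨isCompact_iff_ultrafilter_le_nhds.2 fun 𝒰 _ => ⟨⟨_, hP 𝒰⟩, mem_univ _, ?_⟩⟩
  rw [nhds_generateFrom, le_iInf₂_iff]
  rintro s ⟨hs, a, ha, rfl | rfl⟩
  · exact Filter.le_principal_iff.2 hs.2
  · exact Filter.le_principal_iff.2 (Ultrafilter.compl_mem_iff_notMem.2 fun h => hs ⟨ha, h⟩)

variable [MTLAlgebra A]

theorem isGenPrimeFilter_ultrafilter_limit (h1 : (1 : A) ∈ L)
    (hinf : ∀ a ∈ L, ∀ b ∈ L, a ⊓ b ∈ L) (hP : ∀ F, P F → IsGenPrimeFilter L F)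
    (𝒰 : Ultrafilter {F // P F}) :
    IsGenPrimeFilter L {a | a ∈ L ∧ {F : {F // P F} | a ∈ F.1} ∈ 𝒰} where
  subset := fun _ h => h.1
  nonempty := by
    refine ⟨1, h1, Filter.mem_of_superset Filter.univ_mem fun F _ => ?_⟩
    obtain ⟨a, ha⟩ := (hP _ F.2).nonempty
    exact (hP _ F.2).upper a ha 1 h1 (MTLAlgebra.le_one a)
  upper := fun a ha b hb hab => ⟨hb, Filter.mem_of_superset ha.2 fun F h =>
    (hP _ F.2).upper a h b hb hab⟩
  inf_mem := fun a ha b hb => ⟨hinf a ha.1 b hb.1,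
    Filter.mem_of_superset (Filter.inter_mem ha.2 hb.2) fun F h =>
      (hP _ F.2).inf_mem a h.1 b h.2⟩
  prime := fun a ha b hb h => by
    have : {F : {F // P F} | a ∈ F.1} ∪ {F : {F // P F} | b ∈ F.1} ∈ 𝒰 :=
      Filter.mem_of_superset h.2 fun F h => (hP _ F.2).prime a ha b hb h
    exact (Ultrafilter.union_mem_iff.1 this).imp (fun h => ⟨ha, h⟩) fun h => ⟨hb, h⟩

/-- Nonempty clopen up-sets of a compact space of filters are the basic ones. -/
theorem exists_eq_setOf_mem (h1 : (1 : A) ∈ L) (hsup : ∀ a ∈ L, ∀ b ∈ L, a ⊔ b ∈ L)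
    (hP : ∀ F, P F → IsGenPrimeFilter L F)
    (hc : @CompactSpace {F // P F} (filterTopology L P)) {V : Set {F // P F}}
    (hV : @IsClopen _ (filterTopology L P) V) (hV' : IsUpperSet V) (hne : V.Nonempty) :
    ∃ a ∈ L, V = {F | a ∈ F.1} := by
  let := filterTopology L P
  -- Points outside `V` are not above `F`, so each omits an element of `F`. Compactness of the
  -- complement and closure of `F` under meets give one element that all of them omit.
  have step : ∀ F ∈ V, ∃ a ∈ F.1, {G : {F // P F} | a ∈ G.1} ⊆ V := by
    intro F hF
    have hone : (1 : A) ∈ F.1 := by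
      obtain ⟨a, ha⟩ := (hP _ F.2).nonempty
      exact (hP _ F.2).upper a ha 1 h1 (MTLAlgebra.le_one a)
    have : Nonempty F.1 := ⟨⟨1, hone⟩⟩
    obtain ⟨a, ha⟩ := hV.compl.isClosed.isCompact.elim_directed_cover
      (fun a : F.1 => {G : {F // P F} | a.1 ∈ G.1}ᶜ)
      (fun a => (isClopen_setOf_mem ((hP _ F.2).subset a.2)).compl.isOpen)
      (fun G hG => by
        have : ¬ F ≤ G := fun h => hG (hV' h hF)
        obtain ⟨a, ha, ha'⟩ := not_subset.1 this
        exact mem_iUnion.2 ⟨⟨a, ha⟩, ha'⟩)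
      (fun a b => ⟨⟨a.1 ⊓ b.1, (hP _ F.2).inf_mem _ a.2 _ b.2⟩,
        fun G hG h => hG ((hP _ G.2).upper _ h _ ((hP _ F.2).subset a.2) inf_le_left),
        fun G hG h => hG ((hP _ G.2).upper _ h _ ((hP _ F.2).subset b.2) inf_le_right)⟩)
    exact ⟨a.1, a.2, compl_subset_compl.1 ha⟩
  obtain ⟨F₀, hF₀⟩ := hne
  obtain ⟨a₀, ha₀, haV₀⟩ := step F₀ hF₀
  -- Second use of compactness, now of `V`: the basic sets inside `V` are directed under joins, and
  -- the family is nonempty because `V` is.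
  have : Nonempty {a // a ∈ L ∧ {G : {F // P F} | a ∈ G.1} ⊆ V} :=
    ⟨⟨a₀, (hP _ F₀.2).subset ha₀, haV₀⟩⟩
  obtain ⟨a, ha⟩ := hV.isClosed.isCompact.elim_directed_cover
    (fun a : {a // a ∈ L ∧ {G : {F // P F} | a ∈ G.1} ⊆ V} => {G : {F // P F} | a.1 ∈ G.1})
    (fun a => (isClopen_setOf_mem a.2.1).isOpen)
    (fun G hG => by
      obtain ⟨a, ha, haV⟩ := step G hG
      exact mem_iUnion.2 ⟨⟨a, (hP _ G.2).subset ha, haV⟩, ha⟩)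
    (fun a b => ⟨⟨a.1 ⊔ b.1, hsup _ a.2.1 _ b.2.1, fun G hG =>
        ((hP _ G.2).prime _ a.2.1 _ b.2.1 hG).elim (fun h => a.2.2 h) fun h => b.2.2 h⟩,
      fun G hG => (hP _ G.2).upper _ hG _ (hsup _ a.2.1 _ b.2.1) le_sup_left,
      fun G hG => (hP _ G.2).upper _ hG _ (hsup _ a.2.1 _ b.2.1) le_sup_right⟩)
  exact ⟨a.1, a.2.1, ha.antisymm a.2.2⟩

end FilterSpace

/-! ### Products and residuals of generalized prime filters. -/

section DeductiveFilter

variable {A : Type u} [MTLAlgebra A] {L F G H : Set A} {a b c : A}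

namespace IsDeductiveFilter

theorem inf_mem (hL : IsDeductiveFilter A L) (ha : a ∈ L) (hb : b ∈ L) : a ⊓ b ∈ L :=
  hL.upper mul_le_inf' (hL.mul_mem _ ha _ hb)

theorem himp_mem (hL : IsDeductiveFilter A L) (hb : b ∈ L) : a ⇨ b ∈ L := hL.upper le_himp hb

theorem mem_of_le (hL : IsDeductiveFilter A L) (hF : IsGenPrimeFilter L F) (ha : a ∈ F)
    (h : a ≤ b) : b ∈ F := hF.upper a ha b (hL.upper h (hF.subset ha)) h

theorem one_mem_of (hL : IsDeductiveFilter A L) (hF : IsGenPrimeFilter L F) : (1 : A) ∈ F :=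
  let ⟨a, ha⟩ := hF.nonempty
  hL.mem_of_le hF ha (MTLAlgebra.le_one a)

theorem isGenPrimeFilter_self (hL : IsDeductiveFilter A L) : IsGenPrimeFilter L L :=
  ⟨subset_rfl, ⟨1, hL.one_mem⟩, fun _ _ _ hb _ => hb, fun _ ha _ hb => hL.inf_mem ha hb,
    fun _ ha _ _ _ => Or.inl ha⟩

theorem filterMul_subset_iff (hL : IsDeductiveFilter A L) (hF : F ⊆ L) (hG : G ⊆ L)
    (hH : IsGenPrimeFilter L H) :
    filterMul L F G ⊆ H ↔ ∀ a ∈ F, ∀ b ∈ G, a * b ∈ H :=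
  ⟨fun h a ha b hb => h ⟨hL.mul_mem _ (hF ha) _ (hG hb), a, ha, b, hb, le_rfl⟩,
    fun h _ ⟨_, a, ha, b, hb, hle⟩ => hL.mem_of_le hH (h a ha b hb) hle⟩

/-- For primeness, `a * b ≤ c ⊔ d` gives `a ≤ (b ⇨ c) ⊔ (b ⇨ d)`, so the primeness of `F` alone
decides which of `c`, `d` lies in the product. -/
theorem isGenPrimeFilter_filterMul (hL : IsDeductiveFilter A L) (hF : IsGenPrimeFilter L F)
    (hG : IsGenPrimeFilter L G) : IsGenPrimeFilter L (filterMul L F G) where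
  subset := fun _ h => h.1
  nonempty := ⟨1, hL.one_mem, 1, hL.one_mem_of hF, 1, hL.one_mem_of hG, MTLAlgebra.le_one _⟩
  upper := fun _ ⟨_, a, ha, b, hb, h⟩ _ hc h' => ⟨hc, a, ha, b, hb, h.trans h'⟩
  inf_mem := by
    rintro c ⟨hc, a, ha, b, hb, h⟩ c' ⟨hc', a', ha', b', hb', h'⟩
    exact ⟨hL.inf_mem hc hc', _, hF.inf_mem a ha a' ha', _, hG.inf_mem b hb b' hb',
      le_inf ((mul_mono inf_le_left inf_le_left).trans h)
        ((mul_mono inf_le_right inf_le_right).trans h')⟩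
  prime := by
    rintro c hc d hd ⟨-, a, ha, b, hb, h⟩
    rw [mul_le_iff', himp_sup] at h
    refine (hF.prime _ (hL.himp_mem hc) _ (hL.himp_mem hd) (hL.mem_of_le hF ha h)).imp ?_ ?_
    · exact fun h => ⟨hc, _, h, b, hb, by rw [mul_comm]; exact mul_himp_le⟩
    · exact fun h => ⟨hd, _, h, b, hb, by rw [mul_comm]; exact mul_himp_le⟩

/-- The largest filter `K` with `F • K ⊆ H`. -/
theorem isGenPrimeFilter_residual (hL : IsDeductiveFilter A L) (hH : IsGenPrimeFilter L H)
    (hF : DirectedOn (· ≥ ·) F) (hFH : F ⊆ H) :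
    IsGenPrimeFilter L {b | b ∈ L ∧ ∀ a ∈ F, a * b ∈ H} where
  subset := fun _ h => h.1
  nonempty := ⟨1, hL.one_mem, fun a ha => by rw [mul_one]; exact hFH ha⟩
  upper := fun b hb c hc h =>
    ⟨hc, fun a ha => hL.mem_of_le hH (hb.2 a ha) (mul_mono le_rfl h)⟩
  inf_mem := fun b hb c hc => ⟨hL.inf_mem hb.1 hc.1, fun a ha => by
    rw [mul_inf']; exact hH.inf_mem _ (hb.2 a ha) _ (hc.2 a ha)⟩
  prime := by
    rintro b hb c hc ⟨-, h⟩
    by_contra! hcon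
    have h1 : ∃ a ∈ F, a * b ∉ H := by
      by_contra! h1; exact hcon.1 ⟨hb, h1⟩
    have h2 : ∃ a ∈ F, a * c ∉ H := by
      by_contra! h2; exact hcon.2 ⟨hc, h2⟩
    obtain ⟨a, ha, h1⟩ := h1
    obtain ⟨a', ha', h2⟩ := h2
    -- A common lower bound of the two witnesses contradicts the primeness of `H`; this is why
    -- directedness of `F` suffices.
    obtain ⟨d, hd, hda, hda'⟩ := hF a ha a' ha'
    have h3 := h d hd
    rw [mul_sup'] at h3
    have hdL := hH.subset (hFH hd)
    rcases hH.prime _ (hL.mul_mem _ hdL _ hb) _ (hL.mul_mem _ hdL _ hc) h3 with h4 | h4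
    · exact h1 (hL.mem_of_le hH h4 (mul_mono hda le_rfl))
    · exact h2 (hL.mem_of_le hH h4 (mul_mono hda' le_rfl))

theorem directedOn (hF : IsGenPrimeFilter L F) : DirectedOn (· ≥ ·) F := fun a ha b hb =>
  ⟨a ⊓ b, hF.inf_mem a ha b hb, inf_le_left, inf_le_right⟩

/-- Residuate twice: the residual of `H` by `F` is prime and contains `G`, and the residual of `H`
by that one is prime and contains `F`. No maximality argument is needed, and only `F` has to be
directed. -/
theorem exists_filters (hL : IsDeductiveFilter A L) (hH : IsGenPrimeFilter L H)
    (hF : DirectedOn (· ≥ ·) F) (hFne : F.Nonempty) (hFL : F ⊆ L)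
    (hGne : G.Nonempty) (hGL : G ⊆ L) (h : ∀ a ∈ F, ∀ b ∈ G, a * b ∈ H) :
    ∃ F' G' : Set A, IsGenPrimeFilter L F' ∧ IsGenPrimeFilter L G' ∧ F ⊆ F' ∧ G ⊆ G' ∧
      ∀ a ∈ F', ∀ b ∈ G', a * b ∈ H := by
  obtain ⟨a₀, ha₀⟩ := hFne
  obtain ⟨b₀, hb₀⟩ := hGne
  have hG' := hL.isGenPrimeFilter_residual hH hF
    (fun a ha => hL.mem_of_le hH (h a ha b₀ hb₀) mul_le_left')
  have hF' := hL.isGenPrimeFilter_residual hH (directedOn hG')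
    (fun b hb => hL.mem_of_le hH (hb.2 a₀ ha₀) mul_le_right')
  refine ⟨_, _, hF', hG', fun a ha => ⟨hFL ha, fun b hb => ?_⟩,
    fun b hb => ⟨hGL hb, fun a ha => h a ha b hb⟩, fun a ha b hb => ?_⟩
  · rw [mul_comm]; exact hb.2 a ha
  · rw [mul_comm]; exact ha.2 b hb

end IsDeductiveFilter

end DeductiveFilter

/-! ### The dual of the radical -/

namespace RadicalDual

variable {A : Type u} [SBPAlgebra A] {a b c : A} {x y z w : radicalDual A}

theorem rad : IsDeductiveFilter A (radical A) := isDeductiveFilter_radical A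

theorem subset (x : radicalDual A) : x.1 ⊆ radical A := x.2.subset

theorem one_mem (x : radicalDual A) : (1 : A) ∈ x.1 := rad.one_mem_of x.2

theorem mem_of_le (ha : a ∈ x.1) (h : a ≤ b) : b ∈ x.1 := rad.mem_of_le x.2 ha h

theorem ext (h : x.1 = y.1) : x = y := Subtype.ext h

theorem R_iff : (radicalDual A).R x y z ↔ ∀ a ∈ x.1, ∀ b ∈ y.1, a * b ∈ z.1 :=
  rad.filterMul_subset_iff (subset x) (subset y) z.2

variable (A) in
/-- The greatest point. -/
def top : radicalDual A := ⟨radical A, rad.isGenPrimeFilter_self⟩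

theorem le_top (x : radicalDual A) : x ≤ top A := subset x

/-- The product of two filters, as a point. -/
def mul (x y : radicalDual A) : radicalDual A :=
  ⟨filterMul (radical A) x.1 y.1, rad.isGenPrimeFilter_filterMul x.2 y.2⟩

theorem R_iff_mul_le : (radicalDual A).R x y z ↔ mul x y ≤ z := Iff.rfl

theorem mul_mem_mul (ha : a ∈ x.1) (hb : b ∈ y.1) : a * b ∈ (mul x y).1 :=
  R_iff.1 (R_iff_mul_le.2 le_rfl) a ha b hb

variable (A) in
/-- The set of filters that contain `a`. -/
def basic (a : A) : Set (radicalDual A) := {x | a ∈ x.1}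

instance : CompactSpace (radicalDual A) := compactSpace_filterTopology fun 𝒰 =>
  isGenPrimeFilter_ultrafilter_limit rad.one_mem (fun _ ha _ hb => rad.inf_mem ha hb)
    (fun _ h => h) 𝒰

theorem isClopen_basic (ha : a ∈ radical A) : IsClopen (basic A a) := isClopen_setOf_mem ha

theorem isClopenUpper_basic (ha : a ∈ radical A) :
    (radicalDual A).IsClopenUpper (basic A a) := ⟨isClopen_basic ha, isUpperSet_setOf_mem a⟩

theorem basic_one : basic A 1 = univ := eq_univ_of_forall fun x => one_mem x

theorem exists_eq_basic {V : Set (radicalDual A)} (h : (radicalDual A).IsClopenUpper V)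
    (hne : V.Nonempty) : ∃ a ∈ radical A, V = basic A a :=
  exists_eq_setOf_mem (P := IsGenPrimeFilter (radical A)) rad.one_mem
    (fun _ ha _ _ => rad.upper le_sup_left ha) (fun _ h => h)
    (inferInstanceAs (CompactSpace (radicalDual A))) h.1 h.2 hne

theorem eq_empty_or_exists {V : Set (radicalDual A)} (h : (radicalDual A).IsClopenUpper V) :
    V = ∅ ∨ ∃ a ∈ radical A, V = basic A a :=
  V.eq_empty_or_nonempty.imp_right (exists_eq_basic h)

theorem basic_inf :
    basic A (a ⊓ b) = basic A a ∩ basic A b := by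
  ext x
  exact ⟨fun h => ⟨mem_of_le (x := x) h inf_le_left, mem_of_le (x := x) h inf_le_right⟩,
    fun h => x.2.inf_mem a h.1 b h.2⟩

theorem basic_sup (ha : a ∈ radical A) (hb : b ∈ radical A) :
    basic A (a ⊔ b) = basic A a ∪ basic A b := by
  ext x
  exact ⟨fun h => x.2.prime a ha b hb h, fun h => h.elim
    (fun h => mem_of_le (x := x) h le_sup_left) fun h => mem_of_le (x := x) h le_sup_right⟩

theorem exists_R {F G : Set A} (hF : DirectedOn (· ≥ ·) F) (hFne : F.Nonempty)
    (hFL : F ⊆ radical A) (hGne : G.Nonempty) (hGL : G ⊆ radical A)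
    (h : ∀ a ∈ F, ∀ b ∈ G, a * b ∈ z.1) :
    ∃ x y : radicalDual A, F ⊆ x.1 ∧ G ⊆ y.1 ∧ (radicalDual A).R x y z := by
  obtain ⟨F', G', h1, h2, h3, h4, h5⟩ := rad.exists_filters z.2 hF hFne hFL hGne hGL h
  exact ⟨⟨F', h1⟩, ⟨G', h2⟩, h3, h4, R_iff.2 h5⟩

theorem basic_mul (ha : a ∈ radical A) (hb : b ∈ radical A) :
    (radicalDual A).mul (basic A a) (basic A b) = basic A (a * b) := by
  ext z
  constructor
  · rintro ⟨x, hx, y, hy, h⟩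
    exact R_iff.1 h a hx b hy
  · intro h
    obtain ⟨x, y, hx, hy, h⟩ := exists_R (z := z) (directedOn_singleton a)
      (singleton_nonempty a) (singleton_subset_iff.2 ha) (singleton_nonempty b)
      (singleton_subset_iff.2 hb) (by rintro _ rfl _ rfl; exact h)
    exact ⟨x, hx rfl, y, hy rfl, h⟩

theorem mul_singleton_subset_iff (ha : a ∈ radical A) :
    (radicalDual A).mul {z} (basic A a) ⊆ basic A b ↔ a ⇨ b ∈ z.1 := by
  constructor
  · intro h
    -- The up-set in the radical generated by all `c * a` with `c ∈ z`. As a point it lies in the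
    -- product of `{z}` with `basic A a`, so it must contain `b`.
    have hK : IsGenPrimeFilter (radical A) {c | a ⇨ c ∈ z.1 ∧ c ∈ radical A} :=
      { subset := fun _ h => h.2
        nonempty := ⟨1, mem_of_le (one_mem z) le_himp, rad.one_mem⟩
        upper := fun c hc d hd hcd => ⟨mem_of_le hc.1 (himp_mono hcd), hd⟩
        inf_mem := fun c hc d hd => ⟨by rw [himp_inf]; exact z.2.inf_mem _ hc.1 _ hd.1,
          rad.inf_mem hc.2 hd.2⟩
        prime := by
          rintro c hc d hd ⟨h, -⟩
          rw [himp_sup] at h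
          exact (z.2.prime _ (rad.himp_mem hc) _ (rad.himp_mem hd) h).imp (⟨·, hc⟩) (⟨·, hd⟩) }
    obtain ⟨x, y, hx, hy, hxy⟩ := exists_R (z := ⟨_, hK⟩)
      (IsDeductiveFilter.directedOn z.2) z.2.nonempty (subset z) (singleton_nonempty a)
      (singleton_subset_iff.2 ha) (by
        rintro c hc _ rfl
        exact ⟨mem_of_le hc (mul_le_iff'.1 le_rfl), rad.mul_mem _ (subset z hc) _ ha⟩)
    exact (h ⟨z, rfl, y, hy rfl, R_iff.2 fun c hc d hd => R_iff.1 hxy c (hx hc) d hd⟩ :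
      b ∈ (⟨_, hK⟩ : radicalDual A).1).1
  · rintro h w ⟨_, rfl, y, hy, hR'⟩
    refine mem_of_le (R_iff.1 hR' _ h a hy) ?_
    rw [mul_comm]; exact mul_himp_le

theorem basic_imp (ha : a ∈ radical A) :
    (radicalDual A).imp (basic A a) (basic A b) = basic A (a ⇨ b) := by
  ext z
  exact mul_singleton_subset_iff ha

theorem R_comm : (radicalDual A).R x y z ↔ (radicalDual A).R y x z := by
  rw [R_iff, R_iff]
  exact ⟨fun h a ha b hb => mul_comm b a ▸ h b hb a ha,
    fun h a ha b hb => mul_comm b a ▸ h b hb a ha⟩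

theorem mul_empty (U : Set (radicalDual A)) : (radicalDual A).mul U ∅ = ∅ :=
  eq_empty_of_forall_notMem fun _ ⟨_, _, _, h, _⟩ => h

theorem empty_mul (U : Set (radicalDual A)) : (radicalDual A).mul ∅ U = ∅ :=
  eq_empty_of_forall_notMem fun _ ⟨_, h, _⟩ => h

/-- This disposes of the empty clopen up-set, which is not of the form `basic A a`: no product of a
point with a nonempty one is contained in it. -/
theorem top_mem_mul (x : radicalDual A) (ha : a ∈ radical A) :
    top A ∈ (radicalDual A).mul {x} (basic A a) :=
  ⟨x, rfl, top A, ha, R_iff.2 fun b hb c hc => rad.mul_mem b (subset x hb) c hc⟩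

theorem isClopen_right (U V : Set (radicalDual A)) (hU : (radicalDual A).IsClopenUpper U)
    (hV : (radicalDual A).IsClopenUpper V) :
    IsClopen {z : radicalDual A | (radicalDual A).mul {z} V ⊆ U} := by
  rcases eq_empty_or_exists hV with rfl | ⟨b, hb, rfl⟩
  · simp only [mul_empty, empty_subset, ofPred_true]; exact isClopen_univ
  rcases eq_empty_or_exists hU with rfl | ⟨a, ha, rfl⟩
  · convert isClopen_empty
    exact eq_empty_of_forall_notMem fun x hx => hx (top_mem_mul x hb)
  · simp only [mul_singleton_subset_iff hb]
    exact isClopen_basic (rad.himp_mem ha)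

theorem mul_comm' (U V : Set (radicalDual A)) :
    (radicalDual A).mul U V = (radicalDual A).mul V U := by
  ext z
  constructor <;> exact fun ⟨x, hx, y, hy, h⟩ => ⟨y, hy, x, hx, R_comm.1 h⟩

theorem mul_univ (U : Set (radicalDual A)) (hU : (radicalDual A).IsClopenUpper U) :
    (radicalDual A).mul U univ = U := by
  rcases eq_empty_or_exists hU with rfl | ⟨b, hb, rfl⟩
  · exact empty_mul _
  · rw [← basic_one, basic_mul hb rad.one_mem, mul_one]

theorem E_eq : (radicalDual A).E = univ := eq_univ_of_forall fun x => one_mem x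

theorem mul_assoc_le : mul (mul x y) z ≤ w ↔
    ∀ a ∈ x.1, ∀ b ∈ y.1, ∀ c ∈ z.1, a * b * c ∈ w.1 := by
  rw [← R_iff_mul_le, R_iff]
  constructor
  · exact fun h a ha b hb c hc => h _ (mul_mem_mul ha hb) c hc
  · rintro h d ⟨-, a, ha, b, hb, hd⟩ c hc
    exact mem_of_le (h a ha b hb c hc) (mul_mono hd le_rfl)

/-- The least possible `t` is the product of `x` and `y`. The condition on triple products makes
associativity of `R` immediate. -/
theorem exists_R_R_iff : (∃ t, (radicalDual A).R x y t ∧ (radicalDual A).R t z w) ↔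
    ∀ a ∈ x.1, ∀ b ∈ y.1, ∀ c ∈ z.1, a * b * c ∈ w.1 := by
  rw [← mul_assoc_le]
  constructor
  · rintro ⟨t, h1, h2⟩
    rw [← R_iff_mul_le, R_iff]
    exact fun a ha b hb => R_iff.1 h2 a (R_iff_mul_le.1 h1 ha) b hb
  · exact fun h => ⟨mul x y, le_refl (mul x y), h⟩

theorem isMTL : (radicalDual A).IsMTL where
  compact := inferInstance
  priestley := priestleySpace_filterTopology fun _ h => h.subset
  assoc x y z w := by
    simp only [R_comm (x := x) (z := w)]
    rw [exists_R_R_iff, exists_R_R_iff]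
    constructor
    · intro h b hb c hc a ha
      rw [mul_comm, ← mul_assoc]
      exact h a ha b hb c hc
    · intro h a ha b hb c hc
      rw [mul_assoc, mul_comm]
      exact h b hb c hc a ha
  mono x y z x' y' z' hx hy hz h := R_iff.2 fun a ha b hb => hz (R_iff.1 h a (hx ha) b (hy hb))
  separated x y z h := by
    rw [R_iff] at h
    push Not at h
    obtain ⟨a, ha, b, hb, hab⟩ := h
    refine ⟨_, _, isClopenUpper_basic (subset x ha), isClopenUpper_basic (subset y hb), ha, hb, ?_⟩
    rwa [basic_mul (subset x ha) (subset y hb)]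
  clopen_mul U V hU hV := by
    rcases eq_empty_or_exists hV with rfl | ⟨b, hb, rfl⟩
    · rw [mul_empty]; exact isClopen_empty
    rcases eq_empty_or_exists hU with rfl | ⟨a, ha, rfl⟩
    · rw [empty_mul]; exact isClopen_empty
    · rw [basic_mul ha hb]; exact isClopen_basic (rad.mul_mem _ ha _ hb)
  clopen_right := isClopen_right
  clopen_left U V hU hV := by
    simp only [mul_comm' V]
    exact isClopen_right U V hU hV
  clopenUpper_E := by rw [E_eq]; exact ⟨isClopen_univ, isUpperSet_univ⟩
  mul_E U hU := by rw [E_eq]; exact mul_univ U hU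
  E_mul U hU := by rw [E_eq, mul_comm']; exact mul_univ U hU
  comm _ _ _ := R_comm
  integral := E_eq
  prelinear x y z v w h h' := by
    by_contra! hcon
    obtain ⟨a, ha, ha'⟩ := not_subset.1 hcon.1
    obtain ⟨b, hb, hb'⟩ := not_subset.1 hcon.2
    rw [R_iff] at h h'
    have haL := subset y ha
    have hbL := subset v hb
    -- With `a ∈ y` outside `w` and `b ∈ v` outside `z`, the first implication in `x` would put `b`
    -- into `z`, the second `a` into `w`.
    rcases x.2.prime (a ⇨ b) (rad.himp_mem hbL) (b ⇨ a) (rad.himp_mem haL)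
      (by rw [MTLAlgebra.prelinear]; exact one_mem x) with h1 | h1
    · exact hb' (mem_of_le (h _ h1 a ha) (by rw [mul_comm]; exact mul_himp_le))
    · exact ha' (mem_of_le (h' _ h1 b hb) (by rw [mul_comm]; exact mul_himp_le))

end RadicalDual

variable (A : Type u) [SBPAlgebra A] in
/-- The dual of the radical as a space with a greatest element. -/
def radicalSpace : GMTLSpace.{u} where
  toResSpace := radicalDual A
  isMTL := RadicalDual.isMTL
  greatest := RadicalDual.top A
  le_greatest := RadicalDual.le_top

/-! ### The Stone space of the skeleton -/

section PrimeFilter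

variable {A : Type u} [MTLAlgebra A] {a b c : A}

theorem exists_primeFilter_of_not_le (h : ¬ b ≤ c) :
    ∃ F : Set A, IsPrimeFilter univ F ∧ b ∈ F ∧ c ∉ F := by
  have hdisj : Disjoint ((Order.PFilter.principal b : Order.PFilter A) : Set A)
      (Order.Ideal.principal c : Order.Ideal A) :=
    disjoint_left.2 fun x hx hx' =>
      h (le_trans (Order.PFilter.mem_principal.1 hx) (Order.Ideal.mem_principal.1 hx'))
  obtain ⟨J, hJ, hcJ, hbJ⟩ := DistribLattice.prime_ideal_of_disjoint_filter_ideal hdisj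
  have hb : b ∉ J := disjoint_left.1 hbJ (Order.PFilter.mem_principal.2 le_rfl)
  have hc : c ∈ J := hcJ (Order.Ideal.mem_principal.2 le_rfl)
  refine ⟨(J : Set A)ᶜ, ⟨⟨subset_univ _, ⟨b, hb⟩, ?_, ?_, ?_⟩, ?_⟩, hb, fun h => h hc⟩
  · exact fun x hx y _ hxy hy => hx (J.lower hxy hy)
  · exact fun x hx y hy hxy => (hJ.mem_or_mem hxy).elim hx hy
  · intro x _ y _ hxy
    by_contra! hcon
    exact hxy (J.sup_mem (not_not.1 hcon.1) (not_not.1 hcon.2))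
  · exact fun h => (h.ge (mem_univ c)) hc

theorem IsPrimeFilter.inter_boolSkeleton {F : Set A} (hF : IsPrimeFilter univ F) :
    IsPrimeFilter (boolSkeleton A) (F ∩ boolSkeleton A) where
  subset := inter_subset_right
  nonempty := by
    obtain ⟨a, ha⟩ := hF.nonempty
    exact ⟨1, hF.upper a ha 1 (mem_univ _) (MTLAlgebra.le_one a), one_mem_boolSkeleton⟩
  upper := fun a ha b hb hab => ⟨hF.upper a ha.1 b (mem_univ _) hab, hb⟩
  inf_mem := fun a ha b hb => ⟨hF.inf_mem a ha.1 b hb.1, inf_mem_boolSkeleton ha.2 hb.2⟩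
  prime := fun a ha b hb h =>
    (hF.prime a (mem_univ _) b (mem_univ _) h.1).imp (⟨·, ha⟩) (⟨·, hb⟩)
  proper := fun h => hF.proper <| eq_univ_of_forall fun a =>
    hF.upper ⊥ (h.ge bot_mem_boolSkeleton).1 a (mem_univ _) bot_le

namespace StoneDual

variable {s t : StoneDual A}

theorem subset (s : StoneDual A) : s.1 ⊆ boolSkeleton A := s.2.subset

theorem mem_of_le (hb : b ∈ s.1) (hc : c ∈ boolSkeleton A) (h : b ≤ c) : c ∈ s.1 :=
  s.2.upper b hb c hc h

theorem one_mem (s : StoneDual A) : (1 : A) ∈ s.1 :=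
  let ⟨_, ha⟩ := s.2.nonempty
  mem_of_le ha one_mem_boolSkeleton (MTLAlgebra.le_one _)

theorem bot_notMem (s : StoneDual A) : (⊥ : A) ∉ s.1 := fun h =>
  s.2.proper (s.2.subset.antisymm fun _ hb => mem_of_le h hb bot_le)

theorem neg_mem_iff (hb : b ∈ boolSkeleton A) : neg b ∈ s.1 ↔ b ∉ s.1 := by
  constructor
  · intro h h'
    exact bot_notMem s (inf_neg hb ▸ s.2.inf_mem b h' _ h)
  · intro h
    refine (s.2.prime b hb (neg b) (neg_mem_boolSkeleton hb) ?_).resolve_left h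
    rw [boolSkeleton_iff.1 hb]
    exact one_mem s

theorem inf_mem_iff (hb : b ∈ boolSkeleton A) (hc : c ∈ boolSkeleton A) :
    b ⊓ c ∈ s.1 ↔ b ∈ s.1 ∧ c ∈ s.1 :=
  ⟨fun h => ⟨mem_of_le h hb inf_le_left, mem_of_le h hc inf_le_right⟩,
    fun h => s.2.inf_mem b h.1 c h.2⟩

theorem sup_mem_iff (hb : b ∈ boolSkeleton A) (hc : c ∈ boolSkeleton A) :
    b ⊔ c ∈ s.1 ↔ b ∈ s.1 ∨ c ∈ s.1 :=
  ⟨s.2.prime b hb c hc, fun h => h.elim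
    (fun h => mem_of_le h (sup_mem_boolSkeleton hb hc) le_sup_left)
    fun h => mem_of_le h (sup_mem_boolSkeleton hb hc) le_sup_right⟩

theorem eq_of_subset (h : s.1 ⊆ t.1) : s = t := by
  refine Subtype.ext (h.antisymm fun b hb => ?_)
  by_contra hbs
  have hbB := subset t hb
  exact (neg_mem_iff hbB).1 (h ((neg_mem_iff hbB).2 hbs)) hb

instance : CompactSpace (StoneDual A) := compactSpace_filterTopology fun 𝒰 => by
  refine ⟨isGenPrimeFilter_ultrafilter_limit one_mem_boolSkeleton
    (fun _ ha _ hb => inf_mem_boolSkeleton ha hb) (fun _ h => h.toIsGenPrimeFilter) 𝒰, fun h => ?_⟩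
  have h1 := (h.ge bot_mem_boolSkeleton).2
  obtain ⟨s, hs⟩ := Ultrafilter.nonempty_of_mem h1
  exact bot_notMem s hs

theorem totallySeparatedSpace : TotallySeparatedSpace (StoneDual A) :=
  @PriestleySpace.toTotallySeparatedSpace _ (filterTopology _ _) _
    (priestleySpace_filterTopology fun _ h => h.subset)

instance : TotallyDisconnectedSpace (StoneDual A) :=
  have := totallySeparatedSpace (A := A)
  inferInstance

instance : T2Space (StoneDual A) :=
  have := totallySeparatedSpace (A := A)
  inferInstance

theorem exists_mem_iff (U : Clopens (StoneDual A)) :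
    ∃ b ∈ boolSkeleton A, ∀ s : StoneDual A, s ∈ U ↔ b ∈ s.1 := by
  rcases (U : Set (StoneDual A)).eq_empty_or_nonempty with h | h
  · refine ⟨⊥, bot_mem_boolSkeleton, fun s => ?_⟩
    rw [← SetLike.mem_coe, h]
    exact iff_of_false (notMem_empty s) (bot_notMem s)
  · obtain ⟨b, hb, hU⟩ := exists_eq_setOf_mem (P := IsPrimeFilter (boolSkeleton A))
      one_mem_boolSkeleton (fun _ ha _ hb => sup_mem_boolSkeleton ha hb)
      (fun _ h => h.toIsGenPrimeFilter) (inferInstanceAs (CompactSpace (StoneDual A)))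
      U.isClopen (fun s t hst hs => eq_of_subset hst ▸ hs) h
    exact ⟨b, hb, fun s => by rw [← SetLike.mem_coe, hU]; rfl⟩

/-- The complemented element that corresponds to a clopen set. -/
noncomputable def elt (U : Clopens (StoneDual A)) : A := (exists_mem_iff U).choose

theorem elt_mem (U : Clopens (StoneDual A)) : elt U ∈ boolSkeleton A :=
  (exists_mem_iff U).choose_spec.1

theorem mem_iff {U : Clopens (StoneDual A)} : s ∈ U ↔ elt U ∈ s.1 :=
  (exists_mem_iff U).choose_spec.2 s

theorem le_of_forall (hb : b ∈ boolSkeleton A)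
    (h : ∀ s : StoneDual A, b ∈ s.1 → c ∈ s.1) : b ≤ c := by
  by_contra hle
  obtain ⟨F, hF, hbF, hcF⟩ := exists_primeFilter_of_not_le hle
  exact hcF (h ⟨_, hF.inter_boolSkeleton⟩ ⟨hbF, hb⟩).1

theorem eq_of_forall (hb : b ∈ boolSkeleton A) (hc : c ∈ boolSkeleton A)
    (h : ∀ s : StoneDual A, b ∈ s.1 ↔ c ∈ s.1) : b = c :=
  le_antisymm (le_of_forall hb fun s => (h s).1) (le_of_forall hc fun s => (h s).2)

theorem elt_inf (U V : Clopens (StoneDual A)) : elt (U ⊓ V) = elt U ⊓ elt V :=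
  eq_of_forall (elt_mem _) (inf_mem_boolSkeleton (elt_mem _) (elt_mem _)) fun s => by
    rw [inf_mem_iff (elt_mem _) (elt_mem _), ← mem_iff, ← mem_iff, ← mem_iff]; rfl

theorem elt_sup (U V : Clopens (StoneDual A)) : elt (U ⊔ V) = elt U ⊔ elt V :=
  eq_of_forall (elt_mem _) (sup_mem_boolSkeleton (elt_mem _) (elt_mem _)) fun s => by
    rw [sup_mem_iff (elt_mem _) (elt_mem _), ← mem_iff, ← mem_iff, ← mem_iff]; rfl

theorem elt_bot : elt (⊥ : Clopens (StoneDual A)) = ⊥ :=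
  eq_of_forall (elt_mem _) bot_mem_boolSkeleton fun s => by
    rw [← mem_iff]; exact iff_of_false id (bot_notMem s)

theorem elt_top : elt (⊤ : Clopens (StoneDual A)) = 1 :=
  eq_of_forall (elt_mem _) one_mem_boolSkeleton fun s => by
    rw [← mem_iff]; exact iff_of_true trivial (one_mem s)

/-- The clopen set of a complemented element. -/
def clopen (hb : b ∈ boolSkeleton A) : Clopens (StoneDual A) :=
  ⟨{s | b ∈ s.1}, isClopen_setOf_mem hb⟩

theorem mem_clopen (hb : b ∈ boolSkeleton A) : s ∈ clopen hb ↔ b ∈ s.1 := Iff.rfl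

theorem elt_clopen (hb : b ∈ boolSkeleton A) : elt (clopen hb) = b :=
  eq_of_forall (elt_mem _) hb fun s => by rw [← mem_iff, mem_clopen]

end StoneDual

end PrimeFilter

/-! ### The dual quadruple of an algebra -/

namespace RadicalDual

variable {A : Type u} [SBPAlgebra A] {a b c : A} {x y z w : radicalDual A}

theorem continuous_of_preimage {f : radicalDual A → radicalDual A}
    (h : ∀ a ∈ radical A, ∃ b ∈ radical A, f ⁻¹' basic A a = basic A b) : Continuous f := by
  refine continuous_generateFrom_iff.2 ?_
  rintro _ ⟨a, ha, rfl | rfl⟩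
  · obtain ⟨b, hb, h⟩ := h a ha
    change IsOpen (f ⁻¹' basic A a)
    rw [h]; exact (isClopen_basic hb).isOpen
  · obtain ⟨b, hb, h⟩ := h a ha
    change IsOpen (f ⁻¹' basic A a)ᶜ
    rw [h]; exact (isClopen_basic hb).compl.isOpen

theorem sup_mem_radical (ha : a ∈ radical A) : b ⊔ a ∈ radical A := rad.upper le_sup_right ha

/-- The map dual to the join with `b`. -/
def shift (b : A) (x : radicalDual A) : radicalDual A :=
  ⟨{r | r ∈ radical A ∧ b ⊔ r ∈ x.1},
    { subset := fun _ h => h.1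
      nonempty := ⟨1, rad.one_mem, mem_of_le (one_mem x) le_sup_right⟩
      upper := fun _ ha _ hb hab => ⟨hb, mem_of_le ha.2 (sup_le_sup_left hab _)⟩
      inf_mem := fun _ ha _ hb => ⟨rad.inf_mem ha.1 hb.1, by
        rw [sup_inf_left]; exact x.2.inf_mem _ ha.2 _ hb.2⟩
      prime := by
        rintro r hr r' hr' ⟨-, h⟩
        rw [sup_sup_distrib_left] at h
        exact (x.2.prime _ (sup_mem_radical hr) _ (sup_mem_radical hr') h).imp (⟨hr, ·⟩)
          (⟨hr', ·⟩) }⟩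

theorem mem_shift : a ∈ (shift b x).1 ↔ a ∈ radical A ∧ b ⊔ a ∈ x.1 := Iff.rfl

/-- The preimage of a set under `shift`. -/
def preimageShift (b : A) (V : Set (radicalDual A)) : Set (radicalDual A) := shift b ⁻¹' V

theorem preimageShift_basic (ha : a ∈ radical A) :
    preimageShift b (basic A a) = basic A (b ⊔ a) :=
  Set.ext fun _ => ⟨fun h => h.2, fun h => ⟨ha, h⟩⟩

theorem isMorphism_shift (hb : b ∈ boolSkeleton A) :
    (radicalSpace A).IsMorphism (radicalSpace A) (shift b) where
  left :=
    { continuous := continuous_of_preimage fun _ ha =>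
        ⟨_, sup_mem_radical ha, preimageShift_basic ha⟩
      monotone := fun _ _ h _ ha => ⟨ha.1, h ha.2⟩
      map_R := fun x y z h => R_iff.2 fun r hr r' hr' => ⟨rad.mul_mem _ hr.1 _ hr'.1, by
        rw [← sup_mul_sup hb]; exact R_iff.1 h _ hr.2 _ hr'.2⟩
      lift_R := by
        intro v w z h
        -- The translates of `v` and `w` by `b` need not be filters; `exists_R` enlarges them to
        -- points whose product lies in `z`.
        have hdir : DirectedOn (· ≥ ·) ((b ⊔ ·) '' v.1) := by
          rintro _ ⟨r, hr, rfl⟩ _ ⟨r', hr', rfl⟩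
          exact ⟨_, ⟨_, v.2.inf_mem _ hr _ hr', rfl⟩, sup_le_sup_left inf_le_left _,
            sup_le_sup_left inf_le_right _⟩
        have hsub : ∀ t : radicalDual A, (b ⊔ ·) '' t.1 ⊆ radical A := by
          rintro t _ ⟨r, hr, rfl⟩
          exact sup_mem_radical (subset t hr)
        have hmul : ∀ p ∈ (b ⊔ ·) '' v.1, ∀ q ∈ (b ⊔ ·) '' w.1, p * q ∈ z.1 := by
          rintro _ ⟨r, hr, rfl⟩ _ ⟨r', hr', rfl⟩
          have := (R_iff.1 h r hr r' hr').2
          rwa [← sup_mul_sup hb] at this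
        obtain ⟨x, y, hx, hy, h'⟩ := exists_R hdir (v.2.nonempty.image _) (hsub v)
          (w.2.nonempty.image _) (hsub w) hmul
        exact ⟨x, y, fun a ha => ⟨subset v ha, hx (mem_image_of_mem _ ha)⟩,
          fun a ha => ⟨subset w ha, hy (mem_image_of_mem _ ha)⟩, h'⟩
      map_imp := by
        intro U V hU hV x h
        change (radicalDual A).mul {shift b x} U ⊆ V
        change (radicalDual A).mul {x} (preimageShift b U) ⊆ preimageShift b V at h
        rcases eq_empty_or_exists hU with rfl | ⟨r, hr, rfl⟩
        · rw [mul_empty]; exact empty_subset _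
        rw [preimageShift_basic hr] at h
        rcases eq_empty_or_exists hV with rfl | ⟨r', hr', rfl⟩
        · exact (h (top_mem_mul x (sup_mem_radical hr))).elim
        rw [preimageShift_basic hr'] at h
        rw [mul_singleton_subset_iff hr]
        refine ⟨rad.himp_mem hr', ?_⟩
        rw [← sup_himp_sup hb]
        exact (mul_singleton_subset_iff (sup_mem_radical hr)).1 h
      preimage_E := by
        intro x _
        exact one_mem x }
  right := ext (Subset.antisymm (fun _ h => h.1) fun _ h => ⟨h, sup_mem_radical h⟩)

theorem basic_mem_duals (ha : a ∈ radical A) : basic A a ∈ (radicalSpace A).duals :=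
  ⟨isClopen_basic ha, isUpperSet_setOf_mem a, top A, ha⟩

theorem exists_eq_basic_of_mem_duals {V : Set (radicalDual A)}
    (h : V ∈ (radicalSpace A).duals) : ∃ a ∈ radical A, V = basic A a :=
  exists_eq_basic ⟨h.1, h.2.1⟩ h.2.2

open StoneDual in
-- On basic sets the preimage map sends `a` to `elt U ⊔ a` (`preimageShift_basic`), so the axioms
-- become identities about joins with complemented elements.
theorem isExternalJoin_shift : (radicalSpace A).IsExternalJoin
    (fun (U : Clopens (StoneDual A)) (V : Set (radicalDual A)) => preimageShift (elt U) V) where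
  mapsTo U V hV := by
    obtain ⟨a, ha, rfl⟩ := exists_eq_basic_of_mem_duals hV
    rw [preimageShift_basic ha]
    exact basic_mem_duals (sup_mem_radical ha)
  left_inf _ _ _ _ _ := rfl
  left_sup _ _ _ _ _ := rfl
  left_mul U V hV W hW := by
    obtain ⟨a, ha, rfl⟩ := exists_eq_basic_of_mem_duals hV
    obtain ⟨c, hc, rfl⟩ := exists_eq_basic_of_mem_duals hW
    change preimageShift (elt U) ((radicalDual A).mul _ _) = (radicalDual A).mul _ _
    rw [basic_mul ha hc, preimageShift_basic ha, preimageShift_basic hc,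
      preimageShift_basic (rad.mul_mem _ ha _ hc),
      basic_mul (sup_mem_radical ha) (sup_mem_radical hc), sup_mul_sup (elt_mem U)]
  left_imp U V hV W hW := by
    obtain ⟨a, ha, rfl⟩ := exists_eq_basic_of_mem_duals hV
    obtain ⟨c, hc, rfl⟩ := exists_eq_basic_of_mem_duals hW
    change preimageShift (elt U) ((radicalDual A).imp _ _) = (radicalDual A).imp _ _
    rw [basic_imp ha, preimageShift_basic ha, preimageShift_basic hc,
      preimageShift_basic (rad.himp_mem hc),
      basic_imp (sup_mem_radical ha), sup_himp_sup (elt_mem U)]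
  left_one _ := rfl
  right_inf U U' V hV := by
    obtain ⟨a, ha, rfl⟩ := exists_eq_basic_of_mem_duals hV
    change preimageShift _ (basic A a) = preimageShift _ (basic A a) ∩ preimageShift _ (basic A a)
    rw [preimageShift_basic ha, preimageShift_basic ha, preimageShift_basic ha, elt_inf,
      sup_inf_right, basic_inf]
  right_sup U U' V hV := by
    obtain ⟨a, ha, rfl⟩ := exists_eq_basic_of_mem_duals hV
    change preimageShift _ (basic A a) = preimageShift _ (basic A a) ∪ preimageShift _ (basic A a)
    rw [preimageShift_basic ha, preimageShift_basic ha, preimageShift_basic ha, elt_sup,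
      sup_sup_distrib_right, basic_sup (sup_mem_radical ha) (sup_mem_radical ha)]
  bot_left V hV := by
    obtain ⟨a, ha, rfl⟩ := exists_eq_basic_of_mem_duals hV
    change preimageShift _ (basic A a) = basic A a
    rw [preimageShift_basic ha, elt_bot, bot_sup_eq]
  top_left V hV := by
    obtain ⟨a, ha, rfl⟩ := exists_eq_basic_of_mem_duals hV
    change preimageShift _ (basic A a) = (univ : Set (radicalDual A))
    rw [preimageShift_basic ha, elt_top, eq_one (le_sup_left : (1 : A) ≤ 1 ⊔ a), basic_one]
  sup_sup U U' V hV W hW := by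
    obtain ⟨a, ha, rfl⟩ := exists_eq_basic_of_mem_duals hV
    obtain ⟨c, hc, rfl⟩ := exists_eq_basic_of_mem_duals hW
    change preimageShift _ (basic A a) ∪ preimageShift _ (basic A c) =
      preimageShift _ (basic A a ∪ basic A c)
    rw [← basic_sup ha hc, preimageShift_basic ha, preimageShift_basic hc,
      preimageShift_basic (sup_mem_radical hc),
      ← basic_sup (sup_mem_radical ha) (sup_mem_radical hc), elt_sup, sup_sup_sup_comm]
  sup_comp U U' V hV W hW := by
    obtain ⟨a, ha, rfl⟩ := exists_eq_basic_of_mem_duals hV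
    obtain ⟨c, hc, rfl⟩ := exists_eq_basic_of_mem_duals hW
    have h := sup_mem_radical (b := a) hc
    change preimageShift _ (basic A a ∪ basic A c) =
      preimageShift _ (preimageShift _ (basic A a ∪ basic A c))
    rw [← basic_sup ha hc, preimageShift_basic h, preimageShift_basic h,
      preimageShift_basic (sup_mem_radical h), elt_sup, sup_assoc]

theorem neg_neg_mem (ha : a ∈ radical A) : neg (neg a) ∈ radical A := rad.upper le_neg_neg ha

variable (A) in
/-- The closure operator dual to double negation. -/
def negNeg : ClosureOperator (radicalDual A) where
  toFun x := ⟨{r | r ∈ radical A ∧ neg (neg r) ∈ x.1},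
    { subset := fun _ h => h.1
      nonempty := ⟨1, rad.one_mem, mem_of_le (one_mem x) le_neg_neg⟩
      upper := fun _ ha _ hb hab => ⟨hb, mem_of_le ha.2 (neg_anti (neg_anti hab))⟩
      inf_mem := fun _ ha _ hb => ⟨rad.inf_mem ha.1 hb.1, by
        rw [neg_inf, neg_sup]; exact x.2.inf_mem _ ha.2 _ hb.2⟩
      prime := by
        rintro r hr r' hr' ⟨-, h⟩
        rw [neg_sup, neg_inf] at h
        exact (x.2.prime _ (neg_neg_mem hr) _ (neg_neg_mem hr') h).imp (⟨hr, ·⟩) (⟨hr', ·⟩) }⟩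
  monotone' _ _ h _ ha := ⟨ha.1, h ha.2⟩
  le_closure' x _ ha := ⟨subset x ha, mem_of_le ha le_neg_neg⟩
  idempotent' x := ext <| Set.ext fun a =>
    ⟨fun h => ⟨h.1, neg_neg_neg (a := neg a) ▸ h.2.2⟩,
      fun h => ⟨h.1, neg_neg_mem h.1, by rw [neg_neg_neg]; exact h.2⟩⟩

end RadicalDual

open RadicalDual StoneDual in
variable (A : Type u) [SBPAlgebra A] in
/-- The dual quadruple of an SBP-algebra. -/
noncomputable def quadruple : DualQuadruple.{u} where
  S := StoneDual A
  X := radicalSpace A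
  υ U := shift (elt U)
  isMorphism_υ U := isMorphism_shift (elt_mem U)
  isExternalJoin := isExternalJoin_shift
  Δ := negNeg A
  continuous_Δ := continuous_of_preimage fun _ ha =>
    ⟨_, neg_neg_mem ha, Set.ext fun _ => ⟨fun h => h.2, fun h => ⟨ha, h⟩⟩⟩
  map_R_Δ _ _ _ h := R_iff.2 fun _ ha _ hb => ⟨rad.mul_mem _ ha.1 _ hb.1,
    mem_of_le (R_iff.1 h _ ha.2 _ hb.2) neg_neg_mul_le⟩

/-! ### Prime filters as points of the rotation -/

section Rotation

variable {A : Type u} [SBPAlgebra A] {a b c r r' p q : A} {s s' : StoneDual A}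
  {x y z : radicalDual A}

open RadicalDual (rad neg_neg_mem sup_mem_radical negNeg top)
open StoneDual (elt elt_mem clopen elt_clopen neg_mem_iff)

/-- `s` fixes `x`, in terms of elements. -/
def Fixed (s : StoneDual A) (x : radicalDual A) : Prop :=
  ∀ b ∈ boolSkeleton A, b ∉ s.1 → ∀ r ∈ radical A, b ⊔ r ∈ x.1 → r ∈ x.1

theorem fixes_iff : (quadruple A).Fixes s x ↔ Fixed s x := by
  constructor
  · intro h b hb hbs r hr hx
    have h1 : RadicalDual.shift (elt (clopen hb)) x = x := h (clopen hb) hbs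
    rw [elt_clopen] at h1
    exact h1 ▸ RadicalDual.mem_shift.2 ⟨hr, hx⟩
  · intro h U hU
    refine RadicalDual.ext (Set.ext fun r => ⟨fun hr => ?_, fun hr => ?_⟩)
    · exact h _ (elt_mem U) (fun hs => hU (StoneDual.mem_iff.2 hs)) r hr.1 hr.2
    · exact ⟨x.2.subset hr, RadicalDual.mem_of_le (x := x) hr le_sup_right⟩

/-- The working form of fixedness: within the radical, `x` is closed under consequences modulo `s`.
-/
theorem Fixed.mem_of_inf_le (h : Fixed s x) (hb : b ∈ s.1) (hp : p ∈ x.1) (hr : r ∈ radical A)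
    (hle : b ⊓ p ≤ r) : r ∈ x.1 := by
  have hbB := s.2.subset hb
  refine h (neg b) (neg_mem_boolSkeleton hbB) (fun h1 => (neg_mem_iff hbB).1 h1 hb) r hr ?_
  exact RadicalDual.mem_of_le hp ((inf_le_iff_of_mem hbB).1 hle)

/-- The pairs of the upper part of the rotation, in terms of elements. -/
structure IsUpperPair (s : StoneDual A) (y : radicalDual A) : Prop where
  fixed : Fixed s y
  closed : negNeg A y = y
  ne_top : y ≠ top A

theorem sup_neg_neg (hb : b ∈ boolSkeleton A) : neg (neg (b ⊔ a)) = b ⊔ neg (neg a) := by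
  rw [neg_sup, neg_inf, neg_neg_of_mem hb]

theorem Fixed.negNeg (h : Fixed s x) : Fixed s (negNeg A x) := fun b hb hbs _ hr hx =>
  ⟨hr, h b hb hbs _ (neg_neg_mem hr) (sup_neg_neg hb ▸ hx.2)⟩

theorem IsUpperPair.neg_neg_mem_iff (h : IsUpperPair s y) (hr : r ∈ radical A) :
    neg (neg r) ∈ y.1 ↔ r ∈ y.1 := by
  conv_rhs => rw [← h.closed]
  exact ⟨fun h => ⟨hr, h⟩, fun h => h.2⟩

theorem IsUpperPair.exists_notMem (h : IsUpperPair s y) : ∃ r ∈ radical A, r ∉ y.1 := by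
  by_contra! hcon
  exact h.ne_top (RadicalDual.ext (y.2.subset.antisymm hcon))

/-- Contraposition turns `b ⊓ neg p ≤ neg q` into `b ⊓ q ≤ neg (neg p)`; so `q ∈ y` would give `neg
(neg p) ∈ y` by fixedness and `p ∈ y` by closedness. -/
theorem IsUpperPair.notMem_of_inf_le (h : IsUpperPair s y) (hb : b ∈ s.1) (hp : p ∈ radical A)
    (hpy : p ∉ y.1) (hle : b ⊓ neg p ≤ neg q) : q ∉ y.1 := by
  intro hqy
  have hbB := s.2.subset hb
  apply hpy
  rw [← h.neg_neg_mem_iff hp]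
  refine h.fixed.mem_of_inf_le hb hqy (neg_neg_mem hp) ?_
  rw [← mul_eq_inf hbB] at hle ⊢
  rw [le_neg_iff] at hle ⊢
  rw [mul_left_comm]
  rwa [mul_left_comm, mul_comm q] at hle

/-- A point of the lower part. -/
def lowPoint (s : StoneDual A) (x : radicalDual A) (h : Fixed s x) : (quadruple A).Point :=
  .low ⟨(s, x), fixes_iff.2 h⟩

/-- A point of the upper part. -/
def upPoint (s : StoneDual A) (y : radicalDual A) (h : IsUpperPair s y) :
    (quadruple A).Point :=
  .up ⟨(s, y), ⟨y, fixes_iff.2 h.fixed, h.closed.symm⟩, h.ne_top⟩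

/-- An upper point is given as `Δ x` with `x` fixed. Since `Δ x` is then itself fixed and closed,
the auxiliary `x` can be forgotten. -/
theorem point_cases {motive : (quadruple A).Point → Prop}
    (low : ∀ s x h, motive (lowPoint s x h)) (up : ∀ s y h, motive (upPoint s y h))
    (t : (quadruple A).Point) : motive t := by
  rcases t with ⟨⟨s, x⟩, h⟩ | ⟨⟨s, y⟩, ⟨x, hx, hy⟩, hne⟩
  · exact low s x (fixes_iff.1 h)
  · refine up s y ⟨?_, ?_, hne⟩
    · cases hy; exact (fixes_iff.1 hx).negNeg
    · cases hy; exact (negNeg A).idempotent' x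

/-- The filter of a point of the lower part. -/
def lowFilter (s : StoneDual A) (x : radicalDual A) : Set A :=
  {a | ∃ b ∈ s.1, ∃ p ∈ x.1, b ⊓ p ≤ a}

/-- The filter of a point of the upper part. -/
def upFilter (s : StoneDual A) (y : radicalDual A) : Set A :=
  {a | ∃ b ∈ s.1, ∃ p ∈ radical A, p ∉ y.1 ∧ b ⊓ neg p ≤ a}

/-! ### Prime filters of lower points. -/

theorem mem_lowFilter_of_mem_left (hb : b ∈ s.1) : b ∈ lowFilter s x :=
  ⟨b, hb, 1, RadicalDual.one_mem x, inf_le_left⟩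

theorem mem_lowFilter_of_mem_right (hr : r ∈ x.1) : r ∈ lowFilter s x :=
  ⟨1, s.one_mem, r, hr, inf_le_right⟩

theorem neg_notMem_lowFilter (hr : r ∈ radical A) : neg r ∉ lowFilter s x := by
  rintro ⟨b, hb, p, hp, hle⟩
  exact s.bot_notMem (eq_bot_of_inf_le_neg (s.2.subset hb) (x.2.subset hp) hr hle ▸ hb)

theorem mem_lowFilter_iff_left (hc : c ∈ boolSkeleton A) : c ∈ lowFilter s x ↔ c ∈ s.1 := by
  refine ⟨?_, mem_lowFilter_of_mem_left⟩
  rintro ⟨b, hb, p, hp, hle⟩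
  have hbB := s.2.subset hb
  have h1 : b ⊓ neg c = ⊥ := by
    refine eq_bot_of_inf_le_neg (inf_mem_boolSkeleton hbB (neg_mem_boolSkeleton hc))
      (x.2.subset hp) rad.one_mem ?_
    rw [neg_one, ← inf_neg hc]
    exact le_inf ((inf_le_inf_right _ inf_le_left).trans hle) (inf_le_left.trans inf_le_right)
  by_contra hcs
  exact s.bot_notMem (h1 ▸ s.2.inf_mem _ hb _ ((neg_mem_iff hc).2 hcs))

/-- Fixedness ensures that adjoining `s` adds no radical element, so `x` can be recovered from the
filter. -/
theorem mem_lowFilter_iff_right (h : Fixed s x) (hr : r ∈ radical A) :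
    r ∈ lowFilter s x ↔ r ∈ x.1 :=
  ⟨fun ⟨_, hb, _, hp, hle⟩ => h.mem_of_inf_le hb hp hr hle, mem_lowFilter_of_mem_right⟩

theorem isPrimeFilter_lowFilter (h : Fixed s x) : IsPrimeFilter univ (lowFilter s x) where
  subset := subset_univ _
  nonempty := ⟨1, mem_lowFilter_of_mem_left s.one_mem⟩
  upper := fun _ ⟨b, hb, p, hp, hle⟩ _ _ h => ⟨b, hb, p, hp, hle.trans h⟩
  inf_mem := fun _ ⟨b, hb, p, hp, hle⟩ _ ⟨b', hb', p', hp', hle'⟩ =>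
    ⟨_, s.2.inf_mem _ hb _ hb', _, x.2.inf_mem _ hp _ hp',
      le_inf ((inf_le_inf inf_le_left inf_le_left).trans hle)
        ((inf_le_inf inf_le_right inf_le_right).trans hle')⟩
  prime := by
    rintro a - a' - ⟨b, hb, p, hp, hle⟩
    obtain ⟨u, hu, r, hr, ha⟩ := exists_decomposition a
    obtain ⟨u', hu', r', hr', ha'⟩ := exists_decomposition a'
    have hur : u ⊓ r ≤ a := ha ▸ le_sup_left
    have hur' : u' ⊓ r' ≤ a' := ha' ▸ le_sup_left
    have hau : a ≤ neg u ⊔ r := ha ▸ sup_le (le_sup_of_le_right inf_le_right)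
      (le_sup_of_le_left inf_le_left)
    have hau' : a' ≤ neg u' ⊔ r' := ha' ▸ sup_le (le_sup_of_le_right inf_le_right)
      (le_sup_of_le_left inf_le_left)
    have hnu : a ≤ u ⊔ neg r := ha ▸ sup_le (le_sup_of_le_left inf_le_left)
      (le_sup_of_le_right inf_le_right)
    have hnu' : a' ≤ u' ⊔ neg r' := ha' ▸ sup_le (le_sup_of_le_left inf_le_left)
      (le_sup_of_le_right inf_le_right)
    rw [← inf_le_iff_of_mem hu] at hau
    rw [← inf_le_iff_of_mem hu'] at hau'
    rw [← neg_inf_le_iff_of_mem hu] at hnu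
    rw [← neg_inf_le_iff_of_mem hu'] at hnu'
    -- Modulo `s`, `a` and `a'` may be replaced by `w` and `w'`.
    have split : ∀ v v' w w' : A, v ∈ s.1 → v' ∈ s.1 → v ⊓ a ≤ w → v' ⊓ a' ≤ w' →
        ∃ t ∈ s.1, t ⊓ p ≤ w ⊔ w' := by
      intro v v' w w' hv hv' h1 h2
      refine ⟨_, s.2.inf_mem _ (s.2.inf_mem _ hv _ hv') _ hb, ?_⟩
      have h3 : v ⊓ v' ⊓ b ⊓ p ≤ (v ⊓ v') ⊓ (a ⊔ a') := by
        rw [inf_assoc]; exact inf_le_inf_left _ hle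
      refine h3.trans ?_
      rw [inf_sup_left]
      exact sup_le_sup ((inf_le_inf_right _ inf_le_left).trans h1)
        ((inf_le_inf_right _ inf_le_right).trans h2)
    -- Modulo `s`, `a` is `r` or `neg r` according to whether `u ∈ s`, and likewise `a'`. Two
    -- radical elements are handled by primeness of `x`; in the mixed cases the negation is below
    -- the radical element; two negations cannot occur.
    by_cases hus : u ∈ s.1 <;> by_cases hus' : u' ∈ s.1
    · obtain ⟨t, ht, h1⟩ := split u u' _ _ hus hus' hau hau'
      refine (x.2.prime r hr r' hr' (h.mem_of_inf_le ht hp (sup_mem_radical hr') h1)).imp ?_ ?_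
      · exact fun h => ⟨u, hus, r, h, hur⟩
      · exact fun h => ⟨u', hus', r', h, hur'⟩
    · obtain ⟨t, ht, h1⟩ := split u (neg u') _ _ hus ((neg_mem_iff hu').2 hus') hau hnu'
      exact Or.inl ⟨u, hus, r, h.mem_of_inf_le ht hp hr
        (h1.trans (sup_le le_rfl (neg_le_of_mem hr hr'))), hur⟩
    · obtain ⟨t, ht, h1⟩ := split (neg u) u' _ _ ((neg_mem_iff hu).2 hus) hus' hnu hau'
      exact Or.inr ⟨u', hus', r', h.mem_of_inf_le ht hp hr'
        (h1.trans (sup_le (neg_le_of_mem hr' hr) le_rfl)), hur'⟩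
    · obtain ⟨t, ht, h1⟩ := split (neg u) (neg u') _ _ ((neg_mem_iff hu).2 hus)
        ((neg_mem_iff hu').2 hus') hnu hnu'
      rw [← neg_inf] at h1
      exact (neg_notMem_lowFilter (rad.inf_mem hr hr') ⟨t, ht, p, hp, h1⟩).elim
  proper := fun h1 => neg_notMem_lowFilter (s := s) (x := x) rad.one_mem (h1 ▸ mem_univ _)

/-! ### Prime filters of upper points. -/

theorem IsUpperPair.mem_upFilter_of_mem (h : IsUpperPair s y) (hb : b ∈ s.1) :
    b ∈ upFilter s y :=
  let ⟨r, hr, hry⟩ := h.exists_notMem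
  ⟨b, hb, r, hr, hry, inf_le_left⟩

theorem IsUpperPair.radical_subset (h : IsUpperPair s y) (hp : p ∈ radical A) :
    p ∈ upFilter s y :=
  let ⟨r, hr, hry⟩ := h.exists_notMem
  ⟨1, s.one_mem, r, hr, hry, inf_le_right.trans (neg_le_of_mem hp hr)⟩

theorem IsUpperPair.neg_mem_upFilter_iff (h : IsUpperPair s y) (hr : r ∈ radical A) :
    neg r ∈ upFilter s y ↔ r ∉ y.1 := by
  constructor
  · rintro ⟨b, hb, p, hp, hpy, hle⟩
    exact h.notMem_of_inf_le hb hp hpy hle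
  · exact fun hry => ⟨1, s.one_mem, r, hr, hry, inf_le_right⟩

theorem IsUpperPair.bot_notMem (h : IsUpperPair s y) : (⊥ : A) ∉ upFilter s y := by
  rw [← neg_one, h.neg_mem_upFilter_iff rad.one_mem, not_not]
  exact RadicalDual.one_mem y

theorem upFilter_inf_mem (ha : a ∈ upFilter s y) (hb : b ∈ upFilter s y) :
    a ⊓ b ∈ upFilter s y := by
  obtain ⟨v, hv, p, hp, hpy, hle⟩ := ha
  obtain ⟨v', hv', p', hp', hpy', hle'⟩ := hb
  refine ⟨_, s.2.inf_mem _ hv _ hv', p ⊔ p', sup_mem_radical hp', fun h =>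
    (y.2.prime p hp p' hp' h).elim hpy hpy', ?_⟩
  rw [neg_sup]
  exact le_inf ((inf_le_inf inf_le_left inf_le_left).trans hle)
    ((inf_le_inf inf_le_right inf_le_right).trans hle')

theorem IsUpperPair.mem_upFilter_iff (h : IsUpperPair s y) (hc : c ∈ boolSkeleton A) :
    c ∈ upFilter s y ↔ c ∈ s.1 := by
  refine ⟨fun h1 => ?_, h.mem_upFilter_of_mem⟩
  by_contra hcs
  have h2 := upFilter_inf_mem h1 (h.mem_upFilter_of_mem ((neg_mem_iff hc).2 hcs))
  rw [inf_neg hc] at h2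
  exact h.bot_notMem h2

theorem IsUpperPair.isPrimeFilter_upFilter (h : IsUpperPair s y) :
    IsPrimeFilter univ (upFilter s y) where
  subset := subset_univ _
  nonempty := ⟨1, h.mem_upFilter_of_mem s.one_mem⟩
  upper := fun _ ⟨b, hb, p, hp, hpy, hle⟩ _ _ h => ⟨b, hb, p, hp, hpy, hle.trans h⟩
  inf_mem := fun _ ha _ hb => upFilter_inf_mem ha hb
  prime := by
    rintro a - a' - ⟨b, hb, p, hp, hpy, hle⟩
    obtain ⟨u, hu, r, hr, ha⟩ := exists_decomposition a
    obtain ⟨u', hu', r', hr', ha'⟩ := exists_decomposition a'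
    -- An upper filter contains the whole radical, so only the case in which both elements are
    -- negations modulo `s` is left.
    have large : ∀ v w d : A, v ∈ s.1 → w ∈ radical A → v ⊓ w ≤ d → d ∈ upFilter s y :=
      fun v w d hv hw h1 => ⟨v, hv, p, hp, hpy,
        (inf_le_inf_left _ (neg_le_of_mem hw hp)).trans h1⟩
    by_cases hus : u ∈ s.1
    · exact Or.inl (large u r a hus hr (ha ▸ le_sup_left))
    by_cases hus' : u' ∈ s.1
    · exact Or.inr (large u' r' a' hus' hr' (ha' ▸ le_sup_left))
    have hnu : a ≤ u ⊔ neg r := ha ▸ sup_le (le_sup_of_le_left inf_le_left)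
      (le_sup_of_le_right inf_le_right)
    have hnu' : a' ≤ u' ⊔ neg r' := ha' ▸ sup_le (le_sup_of_le_left inf_le_left)
      (le_sup_of_le_right inf_le_right)
    rw [← neg_inf_le_iff_of_mem hu] at hnu
    rw [← neg_inf_le_iff_of_mem hu'] at hnu'
    have hns := (neg_mem_iff hu).2 hus
    have hns' := (neg_mem_iff hu').2 hus'
    have h1 : neg u ⊓ neg u' ⊓ b ⊓ neg p ≤ neg (r ⊓ r') := by
      rw [inf_assoc]
      refine (inf_le_inf_left _ hle).trans ?_
      rw [inf_sup_left, neg_inf]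
      exact sup_le_sup ((inf_le_inf_right _ inf_le_left).trans hnu)
        ((inf_le_inf_right _ inf_le_right).trans hnu')
    have h2 := h.notMem_of_inf_le (s.2.inf_mem _ (s.2.inf_mem _ hns _ hns') _ hb) hp hpy h1
    by_cases hry : r ∈ y.1
    · have hry' : r' ∉ y.1 := fun h3 => h2 (y.2.inf_mem _ hry _ h3)
      exact Or.inr ⟨_, hns', r', hr', hry', ha' ▸ le_sup_right⟩
    · exact Or.inl ⟨_, hns, r, hr, hry, ha ▸ le_sup_right⟩
  proper := fun h1 => h.bot_notMem (h1 ▸ mem_univ _)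

/-- The set of elements of a point. -/
def pointSet : (quadruple A).Point → Set A
  | .low p => lowFilter (A := A) p.1.1 p.1.2
  | .up p => upFilter (A := A) p.1.1 p.1.2

/-- The prime filter of a point. -/
def toFilter (t : (quadruple A).Point) : dualSpace A :=
  ⟨pointSet t, point_cases (motive := fun t => IsPrimeFilter univ (pointSet t)) (fun _ _ h => isPrimeFilter_lowFilter h)
    (fun _ _ h => h.isPrimeFilter_upFilter) t⟩

theorem toFilter_low (h : Fixed s x) : (toFilter (lowPoint s x h)).1 = lowFilter s x := rfl

theorem toFilter_up (h : IsUpperPair s y) : (toFilter (upPoint s y h)).1 = upFilter s y := rfl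

theorem lowPoint_le_lowPoint {h : Fixed s x} {h' : Fixed s' y} :
    lowPoint s x h ≤ lowPoint s' y h' ↔ s = s' ∧ x ≤ y := Iff.rfl

theorem lowPoint_le_upPoint {h : Fixed s x} {h' : IsUpperPair s' y} :
    lowPoint s x h ≤ upPoint s' y h' ↔ s = s' := Iff.rfl

theorem not_upPoint_le_lowPoint {h : IsUpperPair s x} {h' : Fixed s' y} :
    ¬ upPoint s x h ≤ lowPoint s' y h' := id

theorem upPoint_le_upPoint {h : IsUpperPair s x} {h' : IsUpperPair s' y} :
    upPoint s x h ≤ upPoint s' y h' ↔ s = s' ∧ y ≤ x := Iff.rfl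

/-- The coordinates can be read off from the filter: `s` from its complemented elements, `x` from
its radical elements, and the complement of `y` from the negations, hence the reversed order on
upper points. -/
theorem toFilter_le_iff (t t' : (quadruple A).Point) : toFilter t ≤ toFilter t' ↔ t ≤ t' := by
  change (toFilter t).1 ⊆ (toFilter t').1 ↔ t ≤ t'
  induction t using point_cases with
  | low s x h =>
    induction t' using point_cases with
    | low s' x' h' =>
      rw [toFilter_low, toFilter_low, lowPoint_le_lowPoint]
      constructor
      · intro hle
        refine ⟨StoneDual.eq_of_subset fun b hb => ?_, fun r hr => ?_⟩
        · exact (mem_lowFilter_iff_left (s.2.subset hb)).1 (hle (mem_lowFilter_of_mem_left hb))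
        · exact (mem_lowFilter_iff_right h' (x.2.subset hr)).1
            (hle (mem_lowFilter_of_mem_right hr))
      · rintro ⟨rfl, hx⟩ a ⟨b, hb, p, hp, hle⟩
        exact ⟨b, hb, p, hx hp, hle⟩
    | up s' y h' =>
      rw [toFilter_low, toFilter_up, lowPoint_le_upPoint]
      constructor
      · intro hle
        exact StoneDual.eq_of_subset fun b hb =>
          (h'.mem_upFilter_iff (s.2.subset hb)).1 (hle (mem_lowFilter_of_mem_left hb))
      · rintro rfl a ⟨b, hb, p, hp, hle⟩
        exact h'.isPrimeFilter_upFilter.upper _ (upFilter_inf_mem (h'.mem_upFilter_of_mem hb)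
          (h'.radical_subset (x.2.subset hp))) _ (mem_univ _) hle
  | up s y h =>
    induction t' using point_cases with
    | low s' x' h' =>
      refine iff_of_false (fun hle => ?_) not_upPoint_le_lowPoint
      obtain ⟨r, hr, hry⟩ := h.exists_notMem
      exact neg_notMem_lowFilter hr (hle ((h.neg_mem_upFilter_iff hr).2 hry))
    | up s' y' h' =>
      rw [toFilter_up, toFilter_up, upPoint_le_upPoint]
      constructor
      · intro hle
        refine ⟨StoneDual.eq_of_subset fun b hb => ?_, fun r hr => ?_⟩
        · exact (h'.mem_upFilter_iff (s.2.subset hb)).1 (hle (h.mem_upFilter_of_mem hb))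
        · by_contra hry
          have hrR := y'.2.subset hr
          exact (h'.neg_mem_upFilter_iff hrR).1 (hle ((h.neg_mem_upFilter_iff hrR).2 hry)) hr
      · rintro ⟨rfl, hy⟩ a ⟨b, hb, p, hp, hpy, hle⟩
        exact ⟨b, hb, p, hp, fun h => hpy (hy h), hle⟩

/-- The filter is upper exactly when it contains the negation of a radical element. The De Morgan
laws make the set of `r` with `neg r ∉ F` a generalized prime filter, and the normal form shows that
the coordinates generate `F`. -/
theorem toFilter_surjective : Function.Surjective (toFilter (A := A)) := by
  rintro ⟨F, hF⟩
  have up : ∀ {a b : A}, a ∈ F → a ≤ b → b ∈ F := fun ha h => hF.upper _ ha _ (mem_univ _) h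
  have hone : (1 : A) ∈ F := let ⟨a, ha⟩ := hF.nonempty; up ha (MTLAlgebra.le_one a)
  have prime : ∀ {a b : A}, a ⊔ b ∈ F → a ∈ F ∨ b ∈ F :=
    fun h => hF.prime _ (mem_univ _) _ (mem_univ _) h
  let s : StoneDual A := ⟨_, hF.inter_boolSkeleton⟩
  have hs : ∀ {b : A}, b ∈ s.1 ↔ b ∈ F ∧ b ∈ boolSkeleton A := Iff.rfl
  by_cases hlow : ∃ r ∈ radical A, neg r ∈ F
  · obtain ⟨r₀, hr₀, hr₀F⟩ := hlow
    have hRF : ∀ r ∈ radical A, r ∈ F := fun r hr => up hr₀F (neg_le_of_mem hr hr₀)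
    have hy : IsGenPrimeFilter (radical A) {r | r ∈ radical A ∧ neg r ∉ F} :=
      { subset := fun _ h => h.1
        nonempty := ⟨1, rad.one_mem, fun h => hF.proper <| eq_univ_of_forall fun a =>
          up h (by rw [neg_one]; exact bot_le)⟩
        upper := fun r hr r' hr' hle => ⟨hr', fun h => hr.2 (up h (neg_anti hle))⟩
        inf_mem := fun r hr r' hr' => ⟨rad.inf_mem hr.1 hr'.1, fun h => by
          rw [neg_inf] at h
          exact (prime h).elim hr.2 hr'.2⟩
        prime := by
          rintro r hr r' hr' ⟨-, h⟩
          by_contra! hcon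
          have h1 : neg r ∈ F := by by_contra h1; exact hcon.1 ⟨hr, h1⟩
          have h2 : neg r' ∈ F := by by_contra h2; exact hcon.2 ⟨hr', h2⟩
          exact h (neg_sup (a := r) ▸ hF.inf_mem _ h1 _ h2) }
    have hup : IsUpperPair s ⟨_, hy⟩ :=
      { fixed := by
          rintro b hb hbs r hr ⟨-, h⟩
          refine ⟨hr, fun h1 => h ?_⟩
          rw [neg_sup]
          exact hF.inf_mem _ ((neg_mem_iff hb).2 hbs).1 _ h1
        closed := by
          refine RadicalDual.ext (Set.ext fun r => ⟨fun h => ⟨h.1, fun h1 => h.2.2 ?_⟩,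
            fun h => ⟨h.1, neg_neg_mem h.1, fun h1 => h.2 ?_⟩⟩)
          · rwa [neg_neg_neg]
          · rwa [neg_neg_neg] at h1
        ne_top := fun h =>
          ((congrArg Subtype.val h).ge hr₀ : r₀ ∈ {r | r ∈ radical A ∧ neg r ∉ F}).2 hr₀F }
    refine ⟨upPoint s _ hup, Subtype.ext (Subset.antisymm ?_ fun a ha => ?_)⟩
    · rintro a ⟨b, hb, p, hp, hpy, hle⟩
      have : neg p ∈ F := by by_contra h; exact hpy ⟨hp, h⟩
      exact up (hF.inf_mem _ hb.1 _ this) hle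
    · obtain ⟨u, hu, r, hr, rfl⟩ := exists_decomposition a
      rcases prime ha with h | h
      · exact ⟨u, ⟨up h inf_le_left, hu⟩, r₀, hr₀, fun h => h.2 hr₀F,
          le_sup_of_le_left (inf_le_inf_left _ (neg_le_of_mem hr hr₀))⟩
      · exact ⟨neg u, ⟨up h inf_le_left, neg_mem_boolSkeleton hu⟩, r, hr,
          fun h1 => h1.2 (up h inf_le_right), le_sup_right⟩
  · push Not at hlow
    have hx : IsGenPrimeFilter (radical A) (F ∩ radical A) :=
      { subset := inter_subset_right
        nonempty := ⟨1, hone, rad.one_mem⟩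
        upper := fun r hr r' hr' hle => ⟨up hr.1 hle, hr'⟩
        inf_mem := fun r hr r' hr' => ⟨hF.inf_mem _ hr.1 _ hr'.1, rad.inf_mem hr.2 hr'.2⟩
        prime := fun r hr r' hr' h => (prime h.1).imp (⟨·, hr⟩) (⟨·, hr'⟩) }
    have hfix : Fixed s ⟨_, hx⟩ := fun b hb hbs r hr h =>
      ⟨(prime h.1).resolve_left fun h => hbs ⟨h, hb⟩, hr⟩
    refine ⟨lowPoint s _ hfix, Subtype.ext (Subset.antisymm ?_ fun a ha => ?_)⟩
    · rintro a ⟨b, hb, p, hp, hle⟩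
      exact up (hF.inf_mem _ hb.1 _ hp.1) hle
    · obtain ⟨u, hu, r, hr, rfl⟩ := exists_decomposition a
      rcases prime ha with h | h
      · exact ⟨u, ⟨up h inf_le_left, hu⟩, r, ⟨up h inf_le_right, hr⟩, le_sup_left⟩
      · exact (hlow r hr (up h inf_le_right)).elim

/-! ### Topology -/

/-- By the normal form, every element of `A` arises on the right-hand side. Hence the two subbases
correspond, which gives continuity in both directions. -/
theorem mem_W_iff (U : Clopens (StoneDual A)) (hr : r ∈ radical A)
    (t : (quadruple A).Point) : t ∈ (quadruple A).W U (RadicalDual.basic A r) ↔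
      (elt U ⊓ r) ⊔ (neg (elt U) ⊓ neg r) ∈ (toFilter t).1 := by
  have hF := (toFilter t).2
  have hor : (elt U ⊓ r) ⊔ (neg (elt U) ⊓ neg r) ∈ (toFilter t).1 ↔
      (elt U ∈ (toFilter t).1 ∧ r ∈ (toFilter t).1) ∨
        (neg (elt U) ∈ (toFilter t).1 ∧ neg r ∈ (toFilter t).1) := by
    constructor
    · intro h
      exact (hF.prime _ (mem_univ _) _ (mem_univ _) h).imp
        (fun h => ⟨hF.upper _ h _ (mem_univ _) inf_le_left,
          hF.upper _ h _ (mem_univ _) inf_le_right⟩)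
        (fun h => ⟨hF.upper _ h _ (mem_univ _) inf_le_left,
          hF.upper _ h _ (mem_univ _) inf_le_right⟩)
    · rintro (h | h)
      · exact hF.upper _ (hF.inf_mem _ h.1 _ h.2) _ (mem_univ _) le_sup_left
      · exact hF.upper _ (hF.inf_mem _ h.1 _ h.2) _ (mem_univ _) le_sup_right
  rw [hor]
  clear hor hF
  have hU := elt_mem U
  induction t using point_cases with
  | low s x h =>
    rw [toFilter_low, mem_lowFilter_iff_left hU, mem_lowFilter_iff_right h hr,
      ← StoneDual.mem_iff]
    exact ⟨Or.inl, fun h => h.elim id fun h => (neg_notMem_lowFilter hr h.2).elim⟩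
  | up s y h =>
    rw [toFilter_up, h.mem_upFilter_iff hU, h.mem_upFilter_iff (neg_mem_boolSkeleton hU),
      h.neg_mem_upFilter_iff hr, neg_mem_iff hU, ← StoneDual.mem_iff]
    have himg : y ∈ negNeg A '' RadicalDual.basic A r ↔ r ∈ y.1 := by
      constructor
      · rintro ⟨x, hx, rfl⟩
        exact (negNeg A).le_closure' x hx
      · exact fun hry => ⟨y, hry, h.closed⟩
    rw [← himg]
    have hrF := h.radical_subset hr
    change s ∈ U ∨ y ∉ negNeg A '' RadicalDual.basic A r ↔ _
    tauto

theorem isClopen_dualSpace (a : A) : IsClopen {F : dualSpace A | a ∈ F.1} :=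
  isClopen_setOf_mem (mem_univ a)

theorem continuous_toFilter : Continuous (toFilter (A := A)) := by
  refine continuous_generateFrom_iff.2 ?_
  have key : ∀ a : A, ∃ U : Clopens (StoneDual A), ∃ r ∈ radical A,
      toFilter ⁻¹' {F : dualSpace A | a ∈ F.1} =
        (quadruple A).W U (RadicalDual.basic A r) := by
    intro a
    obtain ⟨b, hb, r, hr, rfl⟩ := exists_decomposition a
    refine ⟨clopen hb, r, hr, Set.ext fun t => ?_⟩
    rw [mem_W_iff _ hr, elt_clopen]
    rfl
  rintro _ ⟨a, -, rfl | rfl⟩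
  · obtain ⟨U, r, hr, h⟩ := key a
    change IsOpen (toFilter ⁻¹' {F : dualSpace A | a ∈ F.1})
    rw [h]
    exact isOpen_generateFrom_of_mem ⟨U, _, RadicalDual.basic_mem_duals hr, Or.inl rfl⟩
  · obtain ⟨U, r, hr, h⟩ := key a
    change IsOpen (toFilter ⁻¹' {F : dualSpace A | a ∈ F.1})ᶜ
    rw [h]
    exact isOpen_generateFrom_of_mem ⟨U, _, RadicalDual.basic_mem_duals hr, Or.inr rfl⟩

theorem continuous_of_rightInverse {g : dualSpace A → (quadruple A).Point}
    (hg : ∀ F, toFilter (g F) = F) : Continuous g := by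
  refine continuous_generateFrom_iff.2 ?_
  have key : ∀ (U : Clopens (StoneDual A)) (V : Set (radicalDual A)),
      V ∈ (radicalSpace A).duals →
        ∃ a : A, g ⁻¹' (quadruple A).W U V = {F : dualSpace A | a ∈ F.1} := by
    intro U V hV
    obtain ⟨r, hr, rfl⟩ := RadicalDual.exists_eq_basic_of_mem_duals hV
    refine ⟨(elt U ⊓ r) ⊔ (neg (elt U) ⊓ neg r),
      Set.ext fun F => (mem_W_iff U hr (g F)).trans ?_⟩
    rw [hg]
    rfl
  rintro _ ⟨U, V, hV, rfl | rfl⟩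
  · obtain ⟨a, h⟩ := key U V hV
    rw [h]
    exact (isClopen_dualSpace a).isOpen
  · obtain ⟨a, h⟩ := key U V hV
    rw [preimage_compl, h]
    exact (isClopen_dualSpace a).compl.isOpen

/-! ### The ternary relation -/

variable (A) in
theorem isDeductiveFilter_univ : IsDeductiveFilter A univ :=
  ⟨mem_univ _, isUpperSet_univ, fun _ _ _ _ => mem_univ _⟩

theorem dualSpace_R_iff {F G H : dualSpace A} :
    (dualSpace A).R F G H ↔ ∀ a ∈ F.1, ∀ b ∈ G.1, a * b ∈ H.1 :=
  (isDeductiveFilter_univ A).filterMul_subset_iff F.2.subset G.2.subset H.2.toIsGenPrimeFilter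

theorem dualSpace_R_comm {F G H : dualSpace A} :
    (dualSpace A).R F G H ↔ (dualSpace A).R G F H := by
  rw [dualSpace_R_iff, dualSpace_R_iff]
  exact ⟨fun h a ha b hb => mul_comm b a ▸ h b hb a ha,
    fun h a ha b hb => mul_comm b a ▸ h b hb a ha⟩

theorem le_of_dualSpace_R {F G H : dualSpace A} (h : (dualSpace A).R F G H) : F ≤ H :=
  fun a ha => mul_one a ▸ dualSpace_R_iff.1 h a ha 1
    ((isDeductiveFilter_univ A).one_mem_of G.2.toIsGenPrimeFilter)

theorem toFilter_mem_of_le {t : (quadruple A).Point} (ha : a ∈ (toFilter t).1) (h : a ≤ b) :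
    b ∈ (toFilter t).1 := (toFilter t).2.upper a ha b (mem_univ _) h

theorem inf_mul_inf (hb : b ∈ boolSkeleton A) (hc : c ∈ boolSkeleton A) :
    (b ⊓ p) * (c ⊓ q) = (b ⊓ c) ⊓ (p * q) := by
  rw [← mul_eq_inf hb, ← mul_eq_inf hc, ← mul_eq_inf (inf_mem_boolSkeleton hb hc),
    ← mul_eq_inf hb, mul_mul_mul_comm]

/-- From `p * q ≤ b ⊔ r` follows `p ≤ b ⊔ (q ⇨ r)`, so fixedness of one factor suffices. -/
theorem Fixed.mul (h : Fixed s x) : Fixed s (RadicalDual.mul x y) := by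
  rintro b hb hbs r hr ⟨-, p, hp, q, hq, hle⟩
  refine ⟨hr, q ⇨ r, ?_, q, hq, by rw [mul_comm]; exact mul_himp_le⟩
  refine h b hb hbs _ (rad.himp_mem hr) (RadicalDual.mem_of_le hp ?_)
  rw [← neg_inf_le_iff_of_mem hb, ← mul_eq_inf (neg_mem_boolSkeleton hb), ← mul_le_iff',
    mul_assoc, mul_eq_inf (neg_mem_boolSkeleton hb), neg_inf_le_iff_of_mem hb]
  exact hle

/-- The largest `z` with `z • x ⊆ y`. -/
def residual (x y : radicalDual A) (h : x.1 ⊆ y.1) : radicalDual A :=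
  ⟨_, rad.isGenPrimeFilter_residual y.2 (IsDeductiveFilter.directedOn x.2) h⟩

theorem isGreatest_residual (h : x.1 ⊆ y.1) :
    IsGreatest {z | (radicalDual A).R z x y} (residual x y h) :=
  ⟨RadicalDual.R_iff.2 fun a ha b hb => by rw [mul_comm]; exact ha.2 b hb, fun z hz a ha =>
    ⟨z.2.subset ha, fun b hb => by rw [mul_comm]; exact RadicalDual.R_iff.1 hz a ha b hb⟩⟩

/-- All three properties come from `y`: `a * (b ⊔ r) ≤ b ⊔ a * r` transfers fixedness, `a * neg (neg
r) ≤ neg (neg (a * r))` closedness, and `1 ∈ x` puts the residual inside `y`. -/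
theorem IsUpperPair.residual (hy : IsUpperPair s y) (h : x.1 ⊆ y.1) :
    IsUpperPair s (residual x y h) where
  fixed := by
    rintro b hb hbs r hr ⟨-, h1⟩
    refine ⟨hr, fun a ha => hy.fixed b hb hbs _ (rad.mul_mem _ (x.2.subset ha) _ hr) ?_⟩
    refine RadicalDual.mem_of_le (h1 a ha) ?_
    rw [mul_sup']
    exact sup_le_sup_right mul_le_right' _
  closed := by
    refine RadicalDual.ext (Subset.antisymm ?_ ((negNeg A).le_closure' _))
    rintro r ⟨hr, -, h1⟩
    refine ⟨hr, fun a ha => ?_⟩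
    rw [← hy.neg_neg_mem_iff (rad.mul_mem _ (x.2.subset ha) _ hr)]
    exact RadicalDual.mem_of_le (h1 a ha)
      ((mul_mono le_neg_neg le_rfl).trans neg_neg_mul_le)
  ne_top := by
    intro htop
    obtain ⟨r, hr, hry⟩ := hy.exists_notMem
    have h1 := ((congrArg Subtype.val htop).ge hr : r ∈ (SBPDual.residual x y h).1).2 1
      (RadicalDual.one_mem x)
    rw [one_mul] at h1
    exact hry h1

/-- The left side has square `⊥`, so it equals its double negation by `neg_sq_himp`. This is why
lower and upper filters multiply through the residual. -/
theorem mul_neg_eq (hq : q ∈ radical A) : p * neg q = neg (p ⇨ neg (neg q)) := by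
  refine le_antisymm ?_ ?_
  · rw [le_neg_iff, ← le_bot_iff, mul_left_comm, ← mul_assoc]
    refine (mul_mono mul_himp_le le_rfl).trans ?_
    rw [mul_comm, mul_neg]
  · have hsq : (p * neg q) * (p * neg q) = ⊥ := by
      rw [← le_bot_iff, ← neg_mul_neg_of_mem hq hq]
      exact mul_mono mul_le_right' mul_le_right'
    have h1 : neg (p * neg q) ≤ p ⇨ neg (neg q) := by
      rw [← mul_le_iff, le_neg_iff, mul_left_comm, ← mul_assoc, mul_neg]
    exact (neg_anti h1).trans (neg_neg_of_sq hsq).le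

theorem R_low_low (h : Fixed s x) (h' : Fixed s' y) (t : (quadruple A).Point) :
    (quadruple A).tensor.R (lowPoint s x h) (lowPoint s' y h') t ↔
      (dualSpace A).R (toFilter (lowPoint s x h)) (toFilter (lowPoint s' y h'))
        (toFilter t) := by
  constructor
  · rintro ⟨w, hw, hwt⟩
    rw [← toFilter_le_iff] at hwt
    rw [dualSpace_R_iff]
    rintro a ⟨b, hb, p, hp, hle⟩ a' ⟨b', hb', p', hp', hle'⟩
    apply hwt
    induction w using point_cases with
    | up => exact hw.elim
    | low s'' z h'' =>
      obtain ⟨h1, h2, h3, -⟩ := hw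
      change s = s' at h1
      change s'' = s at h2
      subst h1 h2
      refine toFilter_mem_of_le ?_ (mul_mono hle hle')
      rw [inf_mul_inf (s''.2.subset hb) (s''.2.subset hb')]
      exact ⟨_, s''.2.inf_mem _ hb _ hb', _, RadicalDual.R_iff.1 h3 p hp p' hp', le_rfl⟩
  · intro hR
    -- Both factors lie below the third point, and comparable points share their ultrafilter.
    have hs : s = s' := by
      have h1 := (toFilter_le_iff _ _).1 (le_of_dualSpace_R hR)
      have h2 := (toFilter_le_iff _ _).1 (le_of_dualSpace_R (dualSpace_R_comm.1 hR))
      clear hR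
      induction t using point_cases with
      | low => exact (lowPoint_le_lowPoint.1 h1).1.trans (lowPoint_le_lowPoint.1 h2).1.symm
      | up => exact (lowPoint_le_upPoint.1 h1).trans (lowPoint_le_upPoint.1 h2).symm
    subst hs
    refine ⟨lowPoint s (RadicalDual.mul x y) h.mul, ⟨rfl, rfl, ?_, ?_⟩, ?_⟩
    · exact RadicalDual.R_iff_mul_le.2 le_rfl
    · exact fun z hz => RadicalDual.R_iff_mul_le.1 hz
    · rw [← toFilter_le_iff]
      rintro a ⟨b, hb, c, ⟨-, p, hp, q, hq, hpq⟩, hle⟩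
      refine toFilter_mem_of_le (dualSpace_R_iff.1 hR (b ⊓ p) ⟨b, hb, p, hp, le_rfl⟩ q
        (mem_lowFilter_of_mem_right hq)) ?_
      rw [← mul_eq_inf (s.2.subset hb), mul_assoc, mul_eq_inf (s.2.subset hb)]
      exact (inf_le_inf_left _ hpq).trans hle

theorem R_low_up (h : Fixed s x) (h' : IsUpperPair s' y) (t : (quadruple A).Point) :
    (quadruple A).tensor.R (lowPoint s x h) (upPoint s' y h') t ↔
      (dualSpace A).R (toFilter (lowPoint s x h)) (toFilter (upPoint s' y h'))
        (toFilter t) := by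
  constructor
  · rintro ⟨w, hw, hwt⟩
    rw [← toFilter_le_iff] at hwt
    rw [dualSpace_R_iff]
    rintro a ⟨b, hb, p, hp, hle⟩ a' ⟨b', hb', q, hq, hqy, hle'⟩
    apply hwt
    induction w using point_cases with
    | low => exact hw.elim
    | up s'' z h'' =>
      obtain ⟨h1, h2, -, h3, -⟩ := hw
      change s = s' at h1
      change s'' = s at h2
      subst h1 h2
      refine toFilter_mem_of_le ?_ (mul_mono hle hle')
      rw [inf_mul_inf (s''.2.subset hb) (s''.2.subset hb'), mul_neg_eq hq]
      have hmem : p ⇨ neg (neg q) ∈ radical A := rad.himp_mem (neg_neg_mem hq)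
      refine ⟨_, s''.2.inf_mem _ hb _ hb', _, hmem, fun h4 => hqy ?_, le_rfl⟩
      have h5 : (radicalDual A).R z x (negNeg A y) := h3
      rw [h'.closed] at h5
      rw [← h'.neg_neg_mem_iff hq]
      refine RadicalDual.mem_of_le (RadicalDual.R_iff.1 h5 _ h4 p hp) ?_
      rw [mul_comm]; exact mul_himp_le
  · intro hR
    have h1 := (toFilter_le_iff _ _).1 (le_of_dualSpace_R hR)
    have h2 := (toFilter_le_iff _ _).1 (le_of_dualSpace_R (dualSpace_R_comm.1 hR))
    rw [dualSpace_R_iff] at hR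
    induction t using point_cases with
    | low => exact h2.elim
    | up s'' z h'' =>
      have hs : s = s' := (lowPoint_le_upPoint.1 h1).trans (upPoint_le_upPoint.1 h2).1.symm
      have hs' : s = s'' := lowPoint_le_upPoint.1 h1
      subst hs hs'
      -- This is where the domain of `∘` comes from: `p ∈ x` outside `y` would put `p * neg p = ⊥`
      -- into the filter of the third point.
      have hxy : x.1 ⊆ y.1 := by
        intro p hp
        by_contra hpy
        have h3 := hR p (mem_lowFilter_of_mem_right hp) (neg p)
          ((h'.neg_mem_upFilter_iff (x.2.subset hp)).2 hpy)
        rw [mul_neg] at h3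
        exact h''.bot_notMem h3
      refine ⟨upPoint s (residual x y hxy) (h'.residual hxy), ⟨rfl, rfl, ?_, ?_⟩, rfl, ?_⟩
      · exact hxy.trans ((negNeg A).le_closure' y)
      · change IsGreatest {z | (radicalDual A).R z x (negNeg A y)} _
        rw [h'.closed]
        exact isGreatest_residual hxy
      · intro r hr
        have hrR := z.2.subset hr
        refine ⟨hrR, fun p hp => ?_⟩
        by_contra hpr
        -- If `p * r ∉ y`, then `p * neg (p * r)` lies in the third filter; being below `neg r`, it
        -- would force `r ∉ z`.
        have hprR := rad.mul_mem _ (x.2.subset hp) _ hrR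
        have h3 := hR p (mem_lowFilter_of_mem_right hp) (neg (p * r))
          ((h'.neg_mem_upFilter_iff hprR).2 hpr)
        refine (h''.neg_mem_upFilter_iff hrR).1
          (h''.isPrimeFilter_upFilter.upper _ h3 _ (mem_univ _) ?_) hr
        rw [le_neg_iff, ← mul_assoc, mul_comm r p, mul_neg]

theorem tensor_R_iff (t t' w : (quadruple A).Point) :
    (quadruple A).tensor.R t t' w ↔
      (dualSpace A).R (toFilter t) (toFilter t') (toFilter w) := by
  induction t using point_cases with
  | low s x h =>
    induction t' using point_cases with
    | low s' x' h' => exact R_low_low h h' w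
    | up s' y h' => exact R_low_up h h' w
  | up s y h =>
    induction t' using point_cases with
    | low s' x' h' =>
      rw [dualSpace_R_comm, ← R_low_up h' h w]
      refine exists_congr fun v => and_congr_left fun _ => ?_
      induction v using point_cases with
      | low => exact Iff.rfl
      | up s'' z h'' =>
        constructor
        · rintro ⟨h1, h2, h3⟩
          exact ⟨h1, h2, h3⟩
        · rintro ⟨h1, h2, h3⟩
          exact ⟨h1, h2, h3⟩
    | up s' y' h' =>
      refine iff_of_false ?_ fun hR => ?_
      · rintro ⟨v, hv, -⟩
        induction v using point_cases with
        | low => exact hv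
        | up => exact hv
      -- Two upper filters contain negations of radical elements, whose product is `⊥`.
      · obtain ⟨r, hr, hry⟩ := h.exists_notMem
        obtain ⟨r', hr', hry'⟩ := h'.exists_notMem
        have h1 := dualSpace_R_iff.1 hR _ ((h.neg_mem_upFilter_iff hr).2 hry) _
          ((h'.neg_mem_upFilter_iff hr').2 hry')
        rw [neg_mul_neg_of_mem hr hr'] at h1
        exact (toFilter w).2.proper (eq_univ_of_forall fun a => toFilter_mem_of_le h1 bot_le)

/-! ### The isomorphism and the main theorem. -/

variable (A) in
/-- Points and prime filters are order isomorphic. -/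
noncomputable def pointOrderIso : (quadruple A).Point ≃o dualSpace A :=
  RelIso.ofSurjective (OrderEmbedding.ofMapLEIff toFilter toFilter_le_iff) toFilter_surjective

theorem toFilter_symm (F : dualSpace A) : toFilter ((pointOrderIso A).symm F) = F :=
  (pointOrderIso A).apply_symm_apply F

variable (A) in
/-- The dual space of an SBP-algebra is the rotation of its dual quadruple. -/
noncomputable def dualSpaceIso : ResSpace.Iso (dualSpace A) (quadruple A).tensor where
  toRelIso := (pointOrderIso A).symm
  continuous_toFun := continuous_of_rightInverse toFilter_symm
  continuous_invFun := continuous_toFilter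
  map_R_iff F G H := (tensor_R_iff _ _ _).trans <| by
    change (dualSpace A).R (toFilter ((pointOrderIso A).symm F))
      (toFilter ((pointOrderIso A).symm G)) (toFilter ((pointOrderIso A).symm H)) ↔ _
    rw [toFilter_symm, toFilter_symm, toFilter_symm]
  map_E_iff F := iff_of_true (mem_univ _)
    ((isDeductiveFilter_univ A).one_mem_of F.2.toIsGenPrimeFilter)

/-- The identity isomorphism. -/
def ResSpace.Iso.refl (Y : ResSpace.{u}) : ResSpace.Iso Y Y where
  toRelIso := OrderIso.refl Y
  continuous_toFun := continuous_id
  continuous_invFun := continuous_id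
  map_R_iff _ _ _ := Iff.rfl
  map_E_iff _ := Iff.rfl

end Rotation

end SBPDual

theorem mainTheorem2 (A : Type u) [SBPDual.SBPAlgebra A] :
    ∃ Q : SBPDual.DualQuadruple.{u},
      Nonempty (SBPDual.ResSpace.Iso (SBPDual.dualSpace A) Q.tensor) ∧
      ∃ (eS : Q.S ≃ₜ SBPDual.StoneDual A)
        (eX : SBPDual.ResSpace.Iso Q.X.toResSpace (SBPDual.radicalDual A)),
        (∀ U : TopologicalSpace.Clopens Q.S, ∃ b ∈ SBPDual.boolSkeleton A,
          (∀ s : Q.S, s ∈ U ↔ b ∈ (eS s).1) ∧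
          ∀ x : Q.X, (eX.toFun (Q.υ U x)).1 =
            {r | r ∈ SBPDual.radical A ∧ b ⊔ r ∈ (eX.toFun x).1}) ∧
        ∀ x : Q.X, (eX.toFun (Q.Δ x)).1 =
          {r | r ∈ SBPDual.radical A ∧ SBPDual.neg (SBPDual.neg r) ∈ (eX.toFun x).1} := by
  refine ⟨SBPDual.quadruple A, ⟨SBPDual.dualSpaceIso A⟩,
    Homeomorph.refl (SBPDual.StoneDual A), SBPDual.ResSpace.Iso.refl (SBPDual.radicalDual A),
    fun U => ?_, fun x => rfl⟩
  exact ⟨SBPDual.StoneDual.elt U, SBPDual.StoneDual.elt_mem U,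
    fun s => SBPDual.StoneDual.mem_iff, fun x => rfl⟩
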